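/- **Setting.** Let $(\Omega,d)$ be a connected metric space with a Borel probability measure $\mu$ without atoms (points are $\mu$-null). $Lip(\Omega)$ is the set of $f:\Omega\to\mathbb R$ that are Lipschitz on every ball; $|\nabla f(x)|=\limsup_{y\to x,\,y\ne x}|f(x)-f(y)|/d(x,y)$ (and $0$ at isolated points). For Borel $A$ let $A_h=\{x:d(x,A)<h\}$ and $\mu^+(A)=\liminf_{h\to0+}(\mu(A_h)-\mu(A))/h$. The isoperimetric profile $I_\Omega$ is the largest function with $\mu^+(A)\ge I_\Omega(\mu(A))$ for all Borel $A$. Call $I:[0,1]\to[0,\infty)$ *regular* if it is concave, continuous, non-decreasing on $(0,1/2)$, symmetric about $1/2$, $I(0)=0$ and $I>0$ on $(0,1)$. Assume that $I_\Omega$ is (finite and) regular and that, for every $f\in Lip(\Omega)$ and $c\in\mathbb R$, $|\nabla f|=0$ $\mu$-a.e. on $\{f=c\}$. An *isoperimetric estimator* is a regular $I$ with $I\le I_\Omega$ on $[0,1]$; in particular $I_\Omega$ is one. A rearrangement invariant (r.i.) space $X$ on $\Omega$ is a Banach function space (with the Fatou property) whose norm depends only on the decreasing rearrangement $f^*_\mu$;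 it is represented by an r.i. space $\bar X$ on $(0,1)$ if $\|f\|_X=\|f_\mu^*\|_{\bar X}$. We say that $\Omega$ has the *Hardy property relative to an estimator $I$* if for all r.i. spaces $X,Y$ on $\Omega$ with representations $\bar X,\bar Y$ the following are equivalent: (1) there is $c$ with $\|f-\int_\Omega f\,d\mu\|_Y\le c\,\||\nabla f|\|_X$ for all $f\in Lip(\Omega)$ (where $f$ is integrable whenever the right-hand side is finite); (2) there is $c_1$ with $\|Q_If\|_{\bar Y}\le c_1\|f\|_{\bar X}$ for all measurable $f\ge0$ on $(0,1)$ vanishing outside $(0,1/2)$, where $Q_If(t)=\int_t^1 f(s)\,ds/I(s)$. $\Omega$ is of *isoperimetric Hardy type* if it has the Hardy property relative to every isoperimetric estimator. Let $1\le q<\infty$ and let $N:[0,\infty)\to[0,\infty)$ be a Young's function (convex, non-decreasing, $N(0)=0$, $N\not\equiv0$) such that $N(t)^{1/q}/t$ is non-decreasing on $(0,\infty)$ and, for some $\alpha>\max\{1/q-1/2,0\}$, $N(t^\alpha)/t$ is non-increasing on $(0,\infty)$. Put $N^{-1}(s)=\sup\{t\ge0:N(t)\le s\}$ and $\|g\|_{L_N}=\inf\{v>0:\int_\Omega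 N(|g|/v)\,d\mu\le1\}$. Consider (E5) there is $P>0$ such that $\|f-m\|_{L_N}\le P\,\||\nabla f|\|_{L^q}$ for all $f\in Lip(\Omega)$ and every median $m$ of $f$ (i.e. $\mu\{f\ge m\}\ge1/2$ and $\mu\{f\le m\}\ge1/2$); (E6) for $I$: there is $c>0$ such that $I(t)\ge c\,\dfrac{t^{1-1/q}}{N^{-1}(1/t)}$ for all $t\in(0,1/2]$. **Theorem.** (a) If $\Omega$ is of isoperimetric Hardy type, then (E5) holds if and only if (E6) holds for every isoperimetric estimator $I$. (b) Without assuming isoperimetric Hardy type, if (E6) holds for every isoperimetric estimator, then (E5) holds. (c) More precisely, for each isoperimetric estimator $I$: (E6) for $I$ implies (E5); and if $\Omega$ has the Hardy property relative to $I$, then (E5) holds if and only if (E6) holds for $I$. -/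

import Mathlib

open MeasureTheory Set Filter Topology
open scoped ENNReal NNReal

noncomputable section

/-! ### Lipschitz functions, perimeter, isoperimetric profile -/

/-- `f` is Lipschitz in every ball. -/
def IsLipOnBalls {Ω : Type*} [MetricSpace Ω] (f : Ω → ℝ) : Prop :=
  ∀ (x : Ω) (r : ℝ), ∃ K : ℝ≥0, LipschitzOnWith K f (Metric.ball x r)

/-- Modulus of the gradient: `limsup_{y → x, y ≠ x} |f x - f y| / d(x, y)`.
At an isolated point the filter is trivial and the value is `0`. -/
def gradMod {Ω : Type*} [MetricSpace Ω] (f : Ω → ℝ) (x : Ω) : ℝ≥0∞ :=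
  limsup (fun y => edist (f x) (f y) / edist x y) (𝓝[≠] x)

/-- Minkowski content `μ⁺(A) = liminf_{h → 0+} (μ(A_h) - μ(A)) / h`, where
`A_h = {x | d(x, A) < h}`. -/
def perimeter {Ω : Type*} [MetricSpace Ω] [MeasurableSpace Ω] (μ : Measure Ω) (A : Set Ω) : ℝ≥0∞ :=
  liminf (fun h : ℝ => (μ (Metric.thickening h A) - μ A) / ENNReal.ofReal h) (𝓝[>] 0)

/-- Isoperimetric profile: the largest function `J` with `J (μ A) ≤ μ⁺(A)` for all Borel sets `A`. -/
def isoProfile {Ω : Type*} [MetricSpace Ω] [MeasurableSpace Ω] (μ : Measure Ω) (t : ℝ) : ℝ≥0∞ :=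
  ⨅ (A : Set Ω) (_ : MeasurableSet A) (_ : μ A = ENNReal.ofReal t), perimeter μ A

/-- The regularity imposed on profiles and their estimators, as functions on `[0, 1]`: concave,
continuous, increasing on `(0, 1/2)`, symmetric about `1/2`, zero at `0`, not degenerate. -/
structure IsProfileShape (I : ℝ → ℝ) : Prop where
  concave : ConcaveOn ℝ (Icc 0 1) I
  continuous : ContinuousOn I (Icc 0 1)
  increasing : MonotoneOn I (Ioo 0 (1 / 2))
  symmetric : ∀ t ∈ Icc (0 : ℝ) 1, I (1 - t) = I t
  zero : I 0 = 0
  pos : ∀ t ∈ Ioo (0 : ℝ) 1, 0 < I t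

/-- The isoperimetric profile is finite and regular on `[0, 1]`. -/
def HasRegularProfile {Ω : Type*} [MetricSpace Ω] [MeasurableSpace Ω] (μ : Measure Ω) : Prop :=
  ∃ J : ℝ → ℝ, IsProfileShape J ∧ ∀ t ∈ Icc (0 : ℝ) 1, isoProfile μ t = ENNReal.ofReal (J t)

/-- `I` is an isoperimetric estimator: a regular function below the isoperimetric profile. -/
def IsIsoperimetricEstimator {Ω : Type*} [MetricSpace Ω] [MeasurableSpace Ω] (μ : Measure Ω)
    (I : ℝ → ℝ) : Prop :=
  IsProfileShape I ∧ ∀ t ∈ Icc (0 : ℝ) 1, ENNReal.ofReal (I t) ≤ isoProfile μ t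

/-- For every `c`, the gradient of a Lipschitz function vanishes a.e. on the level set `{f = c}`. -/
def GradientVanishesOnLevelSets {Ω : Type*} [MetricSpace Ω] [MeasurableSpace Ω]
    (μ : Measure Ω) : Prop :=
  ∀ f : Ω → ℝ, IsLipOnBalls f → ∀ c : ℝ, ∀ᵐ x ∂μ, f x = c → gradMod f x = 0

/-! ### Rearrangement invariant spaces -/

/-- Decreasing rearrangement `f*(s) = inf {t ≥ 0 | ν {f > t} ≤ s}` of a nonnegative function. -/
def rearr {α : Type*} [MeasurableSpace α] (ν : Measure α) (f : α → ℝ≥0∞) (s : ℝ) : ℝ≥0∞ :=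
  sInf {t : ℝ≥0∞ | ν {x | t < f x} ≤ ENNReal.ofReal s}

/-- A rearrangement invariant Banach function norm; the r.i. space consists of the (classes of)
measurable functions `f` for which the norm of `|f|` is finite. -/
structure RINorm {α : Type*} [MeasurableSpace α] (ν : Measure α) where
  toFun : (α → ℝ≥0∞) → ℝ≥0∞
  eq_zero_iff : ∀ f, Measurable f → (toFun f = 0 ↔ f =ᵐ[ν] 0)
  homogeneous : ∀ (c : ℝ≥0) (f), Measurable f → toFun (fun x => (c : ℝ≥0∞) * f x) = c * toFun f
  triangle : ∀ f g, Measurable f → Measurable g → toFun (fun x => f x + g x) ≤ toFun f + toFun g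
  mono : ∀ f g, Measurable f → Measurable g → f ≤ᵐ[ν] g → toFun f ≤ toFun g
  fatou : ∀ F : ℕ → α → ℝ≥0∞, (∀ n, Measurable (F n)) → Monotone F →
    toFun (fun x => ⨆ n, F n x) = ⨆ n, toFun (F n)
  indicator_lt_top : ∀ E, MeasurableSet E → ν E < ∞ → toFun (E.indicator (fun _ => 1)) < ∞
  lintegral_le : ∀ E, MeasurableSet E → ν E < ∞ →
    ∃ C : ℝ≥0, ∀ f, Measurable f → ∫⁻ x in E, f x ∂ν ≤ C * toFun f
  rearrangement_invariant : ∀ f g, Measurable f → Measurable g → rearr ν f = rearr ν g →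
    toFun f = toFun g

/-- Lebesgue measure on the interval `(0, 1)`. -/
def unitMeasure : Measure ℝ := volume.restrict (Ioo 0 1)

/-- `Xbar`, a r.i. space on `(0, 1)`, represents `X`: `‖f‖_X = ‖f*‖_Xbar`. -/
def Represents {Ω : Type*} [MeasurableSpace Ω] {μ : Measure Ω} (X : RINorm μ)
    (Xbar : RINorm unitMeasure) : Prop :=
  ∀ f : Ω → ℝ≥0∞, Measurable f → X.toFun f = Xbar.toFun (rearr μ f)

/-! ### Isoperimetric Hardy type -/

/-- The isoperimetric Hardy operator `Q_I g(t) = ∫_t^1 g(s) / I(s) ds` for `g ≥ 0`. -/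
def isoHardyOp (I : ℝ → ℝ) (g : ℝ → ℝ≥0∞) (t : ℝ) : ℝ≥0∞ :=
  ∫⁻ s in Ioo t 1, g s / ENNReal.ofReal (I s)

/-- The `(Y, X)` Poincaré inequality about the mean (the mean being meaningful when the right-hand
side is finite). -/
def RIPoincare {Ω : Type*} [MetricSpace Ω] [MeasurableSpace Ω] {μ : Measure Ω}
    (X Y : RINorm μ) : Prop :=
  ∃ c : ℝ≥0, ∀ f : Ω → ℝ, IsLipOnBalls f → X.toFun (gradMod f) < ∞ →
    Integrable f μ ∧
      Y.toFun (fun x => ENNReal.ofReal |f x - ∫ y, f y ∂μ|) ≤ c * X.toFun (gradMod f)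

/-- `Q_I` is bounded from `Xbar` to `Ybar` on nonnegative functions supported in `(0, 1/2)`. -/
def IsoHardyBounded (I : ℝ → ℝ) (Xbar Ybar : RINorm unitMeasure) : Prop :=
  ∃ c : ℝ≥0, ∀ g : ℝ → ℝ≥0∞, Measurable g → (∀ s, s ∉ Ioo (0 : ℝ) (1 / 2) → g s = 0) →
    Ybar.toFun (isoHardyOp I g) ≤ c * Xbar.toFun g

/-- The isoperimetric Hardy property relative to one estimator `I`: for all r.i. spaces `X`, `Y`,
the Poincaré inequality is equivalent to the boundedness of `Q_I`. -/
def HardyEquivalence {Ω : Type*} [MetricSpace Ω] [MeasurableSpace Ω] (μ : Measure Ω)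
    (I : ℝ → ℝ) : Prop :=
  ∀ (X Y : RINorm μ) (Xbar Ybar : RINorm unitMeasure), Represents X Xbar → Represents Y Ybar →
    (RIPoincare X Y ↔ IsoHardyBounded I Xbar Ybar)

/-- Isoperimetric Hardy type: the Hardy property holds for any given isoperimetric estimator. -/
def IsIsoperimetricHardyType {Ω : Type*} [MetricSpace Ω] [MeasurableSpace Ω]
    (μ : Measure Ω) : Prop :=
  ∀ I : ℝ → ℝ, IsIsoperimetricEstimator μ I → HardyEquivalence μ I

/-! ### Young's functions and the two statements -/

/-- A Young's function on `[0, ∞)`: convex, non-decreasing, zero at `0`, not identically zero. -/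
structure IsYoungFunction (N : ℝ → ℝ) : Prop where
  convex : ConvexOn ℝ (Ici 0) N
  monotone : MonotoneOn N (Ici 0)
  zero : N 0 = 0
  nontrivial : ∃ t, 0 < t ∧ 0 < N t

/-- `N⁻¹(s) = sup {t ≥ 0 | N t ≤ s}`. -/
def youngInv (N : ℝ → ℝ) (s : ℝ) : ℝ := sSup {t : ℝ | 0 ≤ t ∧ N t ≤ s}

/-- Luxemburg norm of the Orlicz space `L_N`. -/
def luxemburgNorm {Ω : Type*} [MeasurableSpace Ω] (μ : Measure Ω) (N : ℝ → ℝ) (f : Ω → ℝ) : ℝ≥0∞ :=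
  ⨅ (v : ℝ) (_ : 0 < v) (_ : ∫⁻ x, ENNReal.ofReal (N (|f x| / v)) ∂μ ≤ 1), ENNReal.ofReal v

/-- `m` is a median of `f`. -/
def IsMedian {Ω : Type*} [MeasurableSpace Ω] (μ : Measure Ω) (f : Ω → ℝ) (m : ℝ) : Prop :=
  1 / 2 ≤ μ {x | m ≤ f x} ∧ 1 / 2 ≤ μ {x | f x ≤ m}

/-- The `(L_N, L^q)` Poincaré inequality. -/
def OrliczPoincare {Ω : Type*} [MetricSpace Ω] [MeasurableSpace Ω] (μ : Measure Ω)
    (N : ℝ → ℝ) (q : ℝ) : Prop :=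
  ∃ P : ℝ, 0 < P ∧ ∀ f : Ω → ℝ, IsLipOnBalls f → ∀ m : ℝ, IsMedian μ f m →
    luxemburgNorm μ N (fun x => f x - m) ≤
      ENNReal.ofReal P * eLpNorm (gradMod f) (ENNReal.ofReal q) μ

/-- The profile bound `I(t) ≥ c t^{1 - 1/q} / N⁻¹(1/t)` on `(0, 1/2]`. -/
def ProfileBound (N : ℝ → ℝ) (q : ℝ) (I : ℝ → ℝ) : Prop :=
  ∃ c : ℝ, 0 < c ∧ ∀ t ∈ Ioc (0 : ℝ) (1 / 2), c * (t ^ (1 - 1 / q) / youngInv N (1 / t)) ≤ I t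

end

/-! Sufficiency of (E6) is Maz'ya's truncation method. Let `g ≥ 0` be the positive part of `f - m`
or of `m - f`, so that `μ {g > 0} ≤ 1/2`. For `a < b`, the level sets of `g` truncated between `a`
and `b` have measure between `μ {g > b}` and `1/2`; a co-area inequality and Hölder therefore give
`(b - a) I(μ {g > b}) ≤ ‖∇g‖_{L^q(a < g ≤ b)} μ {g > a}^(1 - 1/q)`.

Take `a = 2^k`, `b = 2^(k+1)`, `m k = μ {g > 2^k}` and `x k = (2^k / N⁻¹(1 / m k))^q`. If `m (k+1)`
is much smaller than `m k`, the monotonicity of `N(t^α)/t` makes `N⁻¹(1 / m k)` grow at least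
fourfold and `x (k+1) ≤ x k / 2`. Otherwise the two measures are comparable, and (E6) bounds `x
(k+1)` by the energy in the slab. Hence `∑ x k` is at most a constant times `‖∇g‖_q^q`
(`rpow_level_le`, `sum_le_of_recursion`). Finally `N(l t) ≤ l^q N(t)` for `l ≤ 1`, which is the
monotonicity of `N(t)^(1/q)/t`, turns this sum into a bound for the modular of `g`
(`lintegral_young_le_half`).

For necessity, `L_N` and `L^q` are both Luxemburg spaces, hence r.i. and represented by their
analogues on `(0, 1)`. (E5) implies the Poincaré inequality about the mean, the Hardy property
converts it into boundedness of `Q_I`, and testing on the indicator of `(t, 2t)` gives (E6) at `2t`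
(`IsoHardyBounded.profileBound`). -/

noncomputable section

/-! ### Young functions -/

namespace IsYoungFunction

variable {N : ℝ → ℝ}

theorem nonneg (hN : IsYoungFunction N) {t : ℝ} (ht : 0 ≤ t) : 0 ≤ N t := by
  have := hN.monotone (mem_Ici.2 le_rfl) (mem_Ici.2 ht) ht
  rwa [hN.zero] at this

theorem map_mul_le (hN : IsYoungFunction N) {l t : ℝ} (hl : 0 ≤ l) (hl1 : l ≤ 1) (ht : 0 ≤ t) :
    N (l * t) ≤ l * N t := by
  have := hN.convex.2 (mem_Ici.2 ht) (mem_Ici.2 (le_refl (0 : ℝ))) hl (sub_nonneg.2 hl1)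
    (by ring)
  simpa [hN.zero] using this

theorem mul_le_map (hN : IsYoungFunction N) {s t : ℝ} (hs : 0 < s) (hst : s ≤ t) :
    t / s * N s ≤ N t := by
  have ht : 0 < t := hs.trans_le hst
  have := hN.map_mul_le (l := s / t) (by positivity) ((div_le_one ht).2 hst) ht.le
  rw [div_mul_cancel₀ _ ht.ne'] at this
  calc t / s * N s ≤ t / s * (s / t * N t) := by gcongr
    _ = N t := by field_simp

theorem continuousOn (hN : IsYoungFunction N) : ContinuousOn N (Ici 0) := by
  intro t ht
  rcases (mem_Ici.1 ht).eq_or_lt with rfl | h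
  · have h1 : Tendsto (fun t : ℝ => t * N 1) (𝓝[Ici 0] 0) (𝓝 (N 0)) := by
      have : Tendsto (fun t : ℝ => t * N 1) (𝓝 0) (𝓝 (0 * N 1)) :=
        (continuous_id.mul continuous_const).tendsto 0
      rw [show 0 * N 1 = N 0 by rw [zero_mul, hN.zero]] at this
      exact this.mono_left nhdsWithin_le_nhds
    refine tendsto_of_tendsto_of_tendsto_of_le_of_le' (tendsto_const_nhds (x := N 0)) h1 ?_ ?_
    · filter_upwards [self_mem_nhdsWithin] with s hs
      rw [hN.zero]; exact hN.nonneg hs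
    · filter_upwards [self_mem_nhdsWithin, nhdsWithin_le_nhds (Iio_mem_nhds one_pos)] with s hs hs1
      simpa using hN.map_mul_le hs (le_of_lt hs1) zero_le_one
  · have := hN.convex.continuousOn_interior
    rw [interior_Ici] at this
    exact (this.continuousAt (Ioi_mem_nhds h)).continuousWithinAt

theorem rpow {q : ℝ} (hq : 1 ≤ q) : IsYoungFunction (fun t => t ^ q) where
  convex := convexOn_rpow hq
  monotone := fun _ hs _ _ hst => Real.rpow_le_rpow hs hst (by linarith)
  zero := Real.zero_rpow (by linarith)
  nontrivial := ⟨1, one_pos, by simp⟩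

/-- Antitonicity carries positivity to the left of a point where `N > 0`, monotonicity to the right.
So `N` has no flat piece at `0`, is strictly increasing, and `youngInv N` is its genuine inverse. -/
theorem pos_of_antitoneOn (hN : IsYoungFunction N) {α : ℝ} (hα : 0 < α)
    (hanti : AntitoneOn (fun t => N (t ^ α) / t) (Ioi 0)) {t : ℝ} (ht : 0 < t) : 0 < N t := by
  obtain ⟨t₀, ht₀, hN₀⟩ := hN.nontrivial
  rcases le_total t₀ t with h | h
  · exact hN₀.trans_le (hN.monotone ht₀.le ht.le h)
  · have := hanti (mem_Ioi.2 (Real.rpow_pos_of_pos ht (1 / α)))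
      (mem_Ioi.2 (Real.rpow_pos_of_pos ht₀ (1 / α)))
      (Real.rpow_le_rpow ht.le h (by positivity))
    simp only [← Real.rpow_mul ht.le, ← Real.rpow_mul ht₀.le, one_div_mul_cancel hα.ne',
      Real.rpow_one] at this
    have h0 : 0 < N t / t ^ (1 / α) := lt_of_lt_of_le (by positivity) this
    exact (div_pos_iff_of_pos_right (Real.rpow_pos_of_pos ht _)).1 h0

theorem strictMonoOn (hN : IsYoungFunction N) (hpos : ∀ t, 0 < t → 0 < N t) :
    StrictMonoOn N (Ici 0) := by
  intro s hs t _ hst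
  have ht : 0 < t := lt_of_le_of_lt hs hst
  have := hN.map_mul_le (l := s / t) (div_nonneg hs ht.le) ((div_le_one ht).2 hst.le) ht.le
  rw [div_mul_cancel₀ _ ht.ne'] at this
  refine this.trans_lt ?_
  have h1 : s / t < 1 := (div_lt_one ht).2 hst
  have := hpos t ht
  nlinarith

theorem youngInv_apply (hN : IsYoungFunction N) (hpos : ∀ t, 0 < t → 0 < N t) {w : ℝ}
    (hw : 0 ≤ w) : youngInv N (N w) = w := by
  have : {t : ℝ | 0 ≤ t ∧ N t ≤ N w} = Icc 0 w := by
    ext t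
    refine and_congr_right fun ht => (hN.strictMonoOn hpos).le_iff_le ht hw
  rw [youngInv, this, csSup_Icc hw]

theorem youngInv_spec (hN : IsYoungFunction N) (hpos : ∀ t, 0 < t → 0 < N t) {s : ℝ}
    (hs : 0 < s) : 0 < youngInv N s ∧ N (youngInv N s) = s := by
  have h1 := hpos 1 one_pos
  have hT : s ≤ N (max 1 (s / N 1)) := by
    refine le_trans ?_ (hN.mul_le_map one_pos (le_max_left _ _))
    rw [div_one, ← div_le_iff₀ h1]
    exact le_max_right _ _
  obtain ⟨w, hw, rfl⟩ := intermediate_value_Icc (le_trans zero_le_one (le_max_left 1 (s / N 1)))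
    (hN.continuousOn.mono Icc_subset_Ici_self) ⟨hN.zero.trans_le hs.le, hT⟩
  rw [hN.youngInv_apply hpos hw.1]
  refine ⟨hw.1.lt_of_ne ?_, rfl⟩
  rintro rfl
  exact hs.ne' hN.zero

theorem youngInv_le_youngInv (hN : IsYoungFunction N) (hpos : ∀ t, 0 < t → 0 < N t) {s u : ℝ}
    (hs : 0 < s) (hsu : s ≤ u) : youngInv N s ≤ youngInv N u := by
  have h1 := hN.youngInv_spec hpos hs
  have h2 := hN.youngInv_spec hpos (hs.trans_le hsu)
  rw [← (hN.strictMonoOn hpos).le_iff_le h1.1.le h2.1.le, h1.2, h2.2]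
  exact hsu

theorem youngInv_two_mul_le (hN : IsYoungFunction N) (hpos : ∀ t, 0 < t → 0 < N t) {s : ℝ}
    (hs : 0 < s) : youngInv N (2 * s) ≤ 2 * youngInv N s := by
  have h1 := hN.youngInv_spec hpos hs
  have h2 := hN.youngInv_spec hpos (s := 2 * s) (by positivity)
  rw [← (hN.strictMonoOn hpos).le_iff_le h2.1.le (mem_Ici.2 (by linarith [h1.1])), h2.2]
  have := hN.mul_le_map h1.1 (t := 2 * youngInv N s) (by linarith [h1.1])
  rwa [h1.2, mul_div_cancel_right₀ _ h1.1.ne'] at this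

/-- If `N (t ^ α) / t` is non-increasing, then `N⁻¹(u) / u ^ α` is non-decreasing. -/
theorem youngInv_le_rpow_mul (hN : IsYoungFunction N) {α : ℝ} (hα : 0 < α)
    (hanti : AntitoneOn (fun t => N (t ^ α) / t) (Ioi 0)) {s u : ℝ} (hs : 0 < s) (hsu : s ≤ u) :
    youngInv N s ≤ (s / u) ^ α * youngInv N u := by
  have hpos : ∀ t, 0 < t → 0 < N t := fun t => hN.pos_of_antitoneOn hα hanti
  have hu := hs.trans_le hsu
  have h1 := hN.youngInv_spec hpos hs
  have h2 := hN.youngInv_spec hpos hu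
  have h3 := hN.youngInv_le_youngInv hpos hs hsu
  have := hanti (mem_Ioi.2 (Real.rpow_pos_of_pos h1.1 (1 / α)))
      (mem_Ioi.2 (Real.rpow_pos_of_pos h2.1 (1 / α)))
      (Real.rpow_le_rpow h1.1.le h3 (by positivity))
  simp only [← Real.rpow_mul h1.1.le, ← Real.rpow_mul h2.1.le, one_div_mul_cancel hα.ne',
    Real.rpow_one, h1.2, h2.2] at this
  rw [div_le_div_iff₀ (Real.rpow_pos_of_pos h2.1 _) (Real.rpow_pos_of_pos h1.1 _)] at this
  have h4 : youngInv N s ^ (1 / α) ≤ s / u * youngInv N u ^ (1 / α) := by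
    rw [div_mul_eq_mul_div, le_div_iff₀ hu]; linarith
  have h5 := Real.rpow_le_rpow (Real.rpow_nonneg h1.1.le _) h4 hα.le
  rw [Real.mul_rpow (by positivity) (by have := h2.1; positivity)] at h5
  simpa only [← Real.rpow_mul h1.1.le, ← Real.rpow_mul h2.1.le, one_div_mul_cancel hα.ne',
    Real.rpow_one] using h5

/-- If `N(t)^(1/q) / t` is non-decreasing, then `N(l t) ≤ l ^ q N(t)` for `l ≤ 1`. -/
theorem map_mul_le_rpow (hN : IsYoungFunction N) {q : ℝ} (hq : 0 < q)
    (hmono : MonotoneOn (fun t => N t ^ (1 / q) / t) (Ioi 0)) {l t : ℝ} (hl : 0 ≤ l) (hl1 : l ≤ 1)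
    (ht : 0 < t) : N (l * t) ≤ l ^ q * N t := by
  rcases hl.eq_or_lt with rfl | hl0
  · simp [hN.zero, Real.zero_rpow hq.ne']
  have hlt : 0 < l * t := by positivity
  have := hmono (mem_Ioi.2 hlt) (mem_Ioi.2 ht) (by nlinarith)
  simp only at this
  rw [div_le_div_iff₀ hlt ht] at this
  have h4 : N (l * t) ^ (1 / q) ≤ l * N t ^ (1 / q) := by
    refine le_of_mul_le_mul_right ?_ ht
    linarith
  have h5 := Real.rpow_le_rpow (Real.rpow_nonneg (hN.nonneg hlt.le) _) h4 hq.le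
  rw [Real.mul_rpow hl (Real.rpow_nonneg (hN.nonneg ht.le) _)] at h5
  simpa only [← Real.rpow_mul (hN.nonneg hlt.le), ← Real.rpow_mul (hN.nonneg ht.le),
    one_div_mul_cancel hq.ne', Real.rpow_one] using h5

end IsYoungFunction

/-! ### Lipschitz functions and the modulus of the gradient -/

section Gradient

variable {Ω : Type*} [MetricSpace Ω]

theorem IsLipOnBalls.continuous {f : Ω → ℝ} (hf : IsLipOnBalls f) : Continuous f := by
  refine continuous_iff_continuousAt.2 fun x => ?_
  obtain ⟨K, hK⟩ := hf x 1
  exact hK.continuousOn.continuousAt (Metric.ball_mem_nhds x one_pos)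

theorem IsLipOnBalls.comp_lipschitz {f : Ω → ℝ} (hf : IsLipOnBalls f) {φ : ℝ → ℝ} {L : ℝ≥0}
    (hφ : LipschitzWith L φ) : IsLipOnBalls (fun x => φ (f x)) := fun x r => by
  obtain ⟨K, hK⟩ := hf x r
  exact ⟨L * K, hφ.comp_lipschitzOnWith hK⟩

theorem gradMod_comp_le {φ : ℝ → ℝ} (hφ : LipschitzWith 1 φ) (f : Ω → ℝ) (x : Ω) :
    gradMod (fun x => φ (f x)) x ≤ gradMod f x := by
  refine limsup_le_limsup (Eventually.of_forall fun y => ?_)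
  have := hφ (f x) (f y)
  rw [ENNReal.coe_one, one_mul] at this
  dsimp only
  gcongr

/-- Controls the cost of a cut-off: taking the minimum with a `K`-Lipschitz function adds at most
`K` to the gradient. -/
theorem gradMod_le_of_forall_edist_le {f g : Ω → ℝ} {x : Ω} {K : ℝ≥0∞}
    (h : ∀ y, edist (g x) (g y) ≤ edist (f x) (f y) + K * edist x y) :
    gradMod g x ≤ gradMod f x + K := by
  refine ENNReal.le_of_forall_pos_le_add fun ε hε hlt => ?_
  have hf : gradMod f x < gradMod f x + ε :=
    ENNReal.lt_add_right (fun h => by simp [h] at hlt) (by exact_mod_cast hε.ne')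
  have := eventually_lt_of_limsup_lt hf
  refine limsup_le_of_le (by isBoundedDefault) ?_
  filter_upwards [this, self_mem_nhdsWithin] with y hy hne
  have h0 : edist x y ≠ 0 := by simpa [edist_eq_zero] using (Ne.symm hne)
  calc edist (g x) (g y) / edist x y ≤ (edist (f x) (f y) + K * edist x y) / edist x y := by
        gcongr; exact h y
    _ = edist (f x) (f y) / edist x y + K := by
        rw [ENNReal.add_div, ENNReal.mul_div_cancel_right h0 (edist_ne_top x y)]
    _ ≤ gradMod f x + K + ε := by
        rw [add_right_comm]; gcongr

/-- The limsup is a countable infimum, over radii `1/(n+1)`, of suprema over punctured balls. Each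
supremum is lower semicontinuous in the centre, since a fixed `y` stays in the punctured ball under
small moves of `x` and its quotient is continuous there. -/
theorem measurable_gradMod [MeasurableSpace Ω] [BorelSpace Ω] {f : Ω → ℝ} (hf : Continuous f) :
    Measurable (gradMod f) := by
  have hbasis : ∀ x : Ω, (𝓝[≠] x).HasBasis (fun _ : ℕ => True)
      fun n => Metric.ball x (1 / ((n : ℝ) + 1)) ∩ {x}ᶜ := fun x =>
    nhdsWithin_hasBasis Metric.nhds_basis_ball_inv_nat_succ _
  have heq : gradMod f = fun x => ⨅ n : ℕ,
      ⨆ y ∈ Metric.ball x (1 / ((n : ℝ) + 1)) ∩ {x}ᶜ, edist (f x) (f y) / edist x y := by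
    funext x
    rw [gradMod, (hbasis x).limsup_eq_iInf_iSup]
    simp
  rw [heq]
  refine Measurable.iInf fun n => LowerSemicontinuous.measurable ?_
  intro x t ht
  obtain ⟨y, hy⟩ := lt_iSup_iff.1 ht
  obtain ⟨⟨hyb, hyne⟩, hty⟩ := lt_iSup_iff.1 hy
  have hne : x ≠ y := fun h => hyne h.symm
  have h0 : edist x y ≠ 0 := by simpa [edist_eq_zero] using hne
  have hc : ContinuousAt (fun x' => edist (f x') (f y) / edist x' y) x :=
    ENNReal.Tendsto.div ((hf.edist continuous_const).tendsto x) (Or.inr h0)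
      ((continuous_id.edist continuous_const).tendsto x) (Or.inr (edist_ne_top _ _))
  have hb : ∀ᶠ x' in 𝓝 x, y ∈ Metric.ball x' (1 / ((n : ℝ) + 1)) := by
    have : Metric.ball y (1 / ((n : ℝ) + 1)) ∈ 𝓝 x :=
      Metric.isOpen_ball.mem_nhds (Metric.mem_ball_comm.1 hyb)
    filter_upwards [this] with x' hx' using Metric.mem_ball_comm.1 hx'
  filter_upwards [hc.eventually (lt_mem_nhds hty), hb, isOpen_ne.mem_nhds hne] with x' h1 h2 h3
  exact h1.trans_le (le_iSup₂_of_le y ⟨h2, fun h => h3 h.symm⟩ le_rfl)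

end Gradient

/-! ### The co-area inequality -/

section Coarea

variable {Ω : Type*} [MetricSpace Ω]

/-- The supremum of `u` over the open ball of radius `ε`. -/
def supConv (u : Ω → ℝ) (ε : ℝ) (x : Ω) : ℝ := sSup (u '' Metric.ball x ε)

/-- Thickening every superlevel set amounts to replacing `u` by its local supremum; this links
Minkowski contents to difference quotients of a function. -/
theorem lt_supConv_iff {u : Ω → ℝ} {L : ℝ} (hL : ∀ x, u x ≤ L) {ε : ℝ} (hε : 0 < ε) {x : Ω}
    {t : ℝ} : t < supConv u ε x ↔ x ∈ Metric.thickening ε {y | t < u y} := by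
  have hne : (u '' Metric.ball x ε).Nonempty := ⟨u x, x, Metric.mem_ball_self hε, rfl⟩
  have hbd : BddAbove (u '' Metric.ball x ε) := ⟨L, by rintro _ ⟨y, -, rfl⟩; exact hL y⟩
  rw [supConv, lt_csSup_iff hbd hne, Metric.mem_thickening_iff]
  constructor
  · rintro ⟨_, ⟨y, hy, rfl⟩, ht⟩
    exact ⟨y, ht, Metric.mem_ball'.1 hy⟩
  · rintro ⟨y, ht, hy⟩
    exact ⟨u y, ⟨y, Metric.mem_ball'.2 hy, rfl⟩, ht⟩

theorem le_supConv {u : Ω → ℝ} {L : ℝ} (hL : ∀ x, u x ≤ L) {ε : ℝ} (hε : 0 < ε) (x : Ω) :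
    u x ≤ supConv u ε x :=
  le_csSup ⟨L, by rintro _ ⟨y, -, rfl⟩; exact hL y⟩ ⟨x, Metric.mem_ball_self hε, rfl⟩

theorem supConv_le {u : Ω → ℝ} {ε : ℝ} (hε : 0 < ε) {x : Ω} {c : ℝ}
    (h : ∀ y, dist y x < ε → u y ≤ c) : supConv u ε x ≤ c :=
  csSup_le ⟨u x, x, Metric.mem_ball_self hε, rfl⟩ (by rintro _ ⟨y, hy, rfl⟩; exact h y hy)

theorem limsup_supConv_le {u : Ω → ℝ} {ε : ℕ → ℝ} (hε : ∀ n, 0 < ε n)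
    (hε0 : Tendsto ε atTop (𝓝 0)) (x : Ω) :
    limsup (fun n => ENNReal.ofReal (supConv u (ε n) x - u x) / ENNReal.ofReal (ε n)) atTop ≤
      gradMod u x := by
  refine le_of_forall_gt fun c hc => ?_
  obtain ⟨c', hc', hcc⟩ := ENNReal.lt_iff_exists_nnreal_btwn.1 hc
  refine lt_of_le_of_lt ?_ hcc
  have h1 := eventually_lt_of_limsup_lt hc'
  rw [eventually_nhdsWithin_iff, Metric.eventually_nhds_iff] at h1
  obtain ⟨r, hr, h1⟩ := h1
  refine limsup_le_of_le (by isBoundedDefault) ?_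
  filter_upwards [hε0.eventually (gt_mem_nhds hr)] with n hn
  refine ENNReal.div_le_of_le_mul ?_
  have : supConv u (ε n) x ≤ u x + c' * ε n := by
    refine supConv_le (hε n) fun y hy => ?_
    rcases eq_or_ne y x with rfl | hne
    · have := (hε n).le
      have : 0 ≤ c' * ε n := by positivity
      linarith
    have h2 := h1 (hy.trans hn) hne
    have h0 : edist x y ≠ 0 := by simpa [edist_eq_zero] using hne.symm
    rw [ENNReal.div_lt_iff (Or.inl h0) (Or.inl (edist_ne_top _ _))] at h2
    have h3 : dist (u x) (u y) < c' * dist x y := by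
      have h4 := ENNReal.toReal_strict_mono (by finiteness) h2
      simpa [edist_dist, ENNReal.toReal_mul, ENNReal.toReal_ofReal dist_nonneg] using h4
    have h5 : (c' : ℝ) * dist x y ≤ c' * ε n := by rw [dist_comm x y]; gcongr
    have h6 := neg_abs_le (u x - u y)
    rw [← Real.dist_eq] at h6
    linarith
  calc ENNReal.ofReal (supConv u (ε n) x - u x) ≤ ENNReal.ofReal (c' * ε n) :=
        ENNReal.ofReal_le_ofReal (by linarith)
    _ = c' * ENNReal.ofReal (ε n) := by
        rw [ENNReal.ofReal_mul c'.coe_nonneg, ENNReal.ofReal_coe_nnreal]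

variable [MeasurableSpace Ω] [BorelSpace Ω]

theorem measurable_supConv {u : Ω → ℝ} {L : ℝ} (hL : ∀ x, u x ≤ L) {ε : ℝ} (hε : 0 < ε) :
    Measurable (supConv u ε) := by
  refine measurable_of_Ioi fun t => ?_
  have : supConv u ε ⁻¹' Ioi t = Metric.thickening ε {y | t < u y} := by
    ext x; exact lt_supConv_iff hL hε
  rw [this]
  exact Metric.isOpen_thickening.measurableSet

/-- Co-area inequality for a bounded function with bounded support, with a uniform lower bound for
the perimeters of its superlevel sets. -/
theorem ofReal_mul_le_lintegral_gradMod (μ : Measure Ω) [IsProbabilityMeasure μ] {u : Ω → ℝ}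
    (hu : IsLipOnBalls u) {L : ℝ} (h0 : ∀ x, 0 ≤ u x) (hL : ∀ x, u x ≤ L) {x₀ : Ω} {R : ℝ}
    (hR : ∀ x, R ≤ dist x x₀ → u x = 0) {v : ℝ≥0∞}
    (hv : ∀ t ∈ Ioo 0 L, v ≤ perimeter μ {x | t < u x}) :
    ENNReal.ofReal L * v ≤ ∫⁻ x, gradMod u x ∂μ := by
  set ε : ℕ → ℝ := fun n => 1 / ((n : ℝ) + 1) with hεdef
  have hε : ∀ n, 0 < ε n := fun n => Nat.one_div_pos_of_nat
  have hε1 : ∀ n, ε n ≤ 1 := fun n => by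
    rw [hεdef]; exact (div_le_one (by positivity)).2 (by linarith [(n.cast_nonneg : (0:ℝ) ≤ n)])
  have hε0 : Tendsto ε atTop (𝓝 0) := tendsto_one_div_add_atTop_nhds_zero_nat
  have hum := hu.continuous.measurable
  have hHm : ∀ n, Measurable (supConv u (ε n)) := fun n => measurable_supConv hL (hε n)
  have hHum : ∀ n, Measurable fun x => supConv u (ε n) x - u x := fun n => (hHm n).sub hum
  have hH0 : ∀ n x, 0 ≤ supConv u (ε n) x := fun n x => (h0 x).trans (le_supConv hL (hε n) x)
  have hsm : Measurable fun t : ℝ => μ {x | t < u x} :=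
    Antitone.measurable fun t t' htt => measure_mono fun x (hx : t' < u x) => htt.trans_lt hx
  have hdm : ∀ n, Measurable fun t : ℝ =>
      μ (Metric.thickening (ε n) {x | t < u x}) - μ {x | t < u x} := fun n =>
    Measurable.sub (Antitone.measurable fun t t' htt => measure_mono
      (Metric.thickening_subset_of_subset _ fun x (hx : t' < u x) => htt.trans_lt hx)) hsm
  -- The layer-cake formula for `supConv u (ε n)` and for `u`, subtracted. Boundedness of `u` makes
  -- the subtracted integral finite.
  have hlc : ∀ n, ∫⁻ t in Ioi (0 : ℝ),
      (μ (Metric.thickening (ε n) {x | t < u x}) - μ {x | t < u x}) / ENNReal.ofReal (ε n) =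
      ∫⁻ x, ENNReal.ofReal (supConv u (ε n) x - u x) / ENNReal.ofReal (ε n) ∂μ := by
    intro n
    simp_rw [div_eq_mul_inv]
    rw [lintegral_mul_const _ (hdm n),
      lintegral_mul_const _ (hHum n).ennreal_ofReal]
    congr 1
    have e1 := lintegral_eq_lintegral_meas_lt μ (Eventually.of_forall (hH0 n)) (hHm n).aemeasurable
    have e2 := lintegral_eq_lintegral_meas_lt μ (Eventually.of_forall h0) hum.aemeasurable
    simp_rw [lt_supConv_iff hL (hε n), ofPred_mem_eq] at e1
    have hfin : ∫⁻ x, ENNReal.ofReal (u x) ∂μ ≠ ∞ := by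
      refine ne_top_of_le_ne_top (b := ENNReal.ofReal L) ENNReal.ofReal_ne_top ?_
      calc _ ≤ ∫⁻ _, ENNReal.ofReal L ∂μ := lintegral_mono fun x => ENNReal.ofReal_le_ofReal (hL x)
        _ = _ := by simp
    rw [lintegral_sub hsm (by rw [e2] at hfin; exact hfin) (Eventually.of_forall
      fun t => measure_mono (Metric.self_subset_thickening (hε n) _)), ← e1, ← e2]
    rw [← lintegral_sub hum.ennreal_ofReal hfin (Eventually.of_forall
      fun x => ENNReal.ofReal_le_ofReal (le_supConv hL (hε n) x))]
    exact lintegral_congr fun x => (ENNReal.ofReal_sub _ (h0 x)).symm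
  -- The reverse Fatou lemma needs a uniform majorant, while `u` is only Lipschitz on balls. Within
  -- distance `R + 1` of `x₀` the Lipschitz constant on the ball of radius `R + 2` serves, as `ε n ≤
  -- 1`; farther out, `u` vanishes at all points within `ε n`.
  obtain ⟨K, hK⟩ := hu x₀ (R + 2)
  have hbound : ∀ n x, ENNReal.ofReal (supConv u (ε n) x - u x) / ENNReal.ofReal (ε n) ≤ K := by
    intro n x
    refine ENNReal.div_le_of_le_mul ?_
    have : supConv u (ε n) x ≤ u x + K * ε n := by
      have hKε : 0 ≤ K * ε n := by have := (hε n).le; positivity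
      refine supConv_le (hε n) fun y hy => ?_
      have hy1 := hy.trans_le (hε1 n)
      by_cases hx : dist x x₀ < R + 1
      · have := hK.dist_le_mul y (Metric.mem_ball.2 (by linarith [dist_triangle y x x₀])) x
          (Metric.mem_ball.2 (by linarith))
        have h3 : (K : ℝ) * dist y x ≤ K * ε n := by gcongr
        have h6 := le_abs_self (u y - u x)
        rw [← Real.dist_eq] at h6
        linarith
      · rw [hR y (by linarith [dist_triangle_left x x₀ y])]
        linarith [h0 x]
    calc ENNReal.ofReal (supConv u (ε n) x - u x) ≤ ENNReal.ofReal (K * ε n) :=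
        ENNReal.ofReal_le_ofReal (by linarith)
    _ = K * ENNReal.ofReal (ε n) := by
        rw [ENNReal.ofReal_mul K.coe_nonneg, ENNReal.ofReal_coe_nnreal]
  have hεw : Tendsto ε atTop (𝓝[>] 0) :=
    tendsto_nhdsWithin_iff.2 ⟨hε0, Eventually.of_forall hε⟩
  calc ENNReal.ofReal L * v = ∫⁻ _ in Ioo (0 : ℝ) L, v := by simp [mul_comm]
    _ ≤ ∫⁻ t in Ioo (0 : ℝ) L, liminf (fun n =>
        (μ (Metric.thickening (ε n) {x | t < u x}) - μ {x | t < u x}) / ENNReal.ofReal (ε n))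
          atTop := by
        refine setLIntegral_mono' measurableSet_Ioo fun t ht => (hv t ht).trans ?_
        exact liminf_le_liminf_of_le hεw (by isBoundedDefault) (by isBoundedDefault)
    _ ≤ ∫⁻ t in Ioi (0 : ℝ), liminf (fun n =>
        (μ (Metric.thickening (ε n) {x | t < u x}) - μ {x | t < u x}) / ENNReal.ofReal (ε n))
          atTop := lintegral_mono_set Ioo_subset_Ioi_self
    _ ≤ liminf (fun n => ∫⁻ t in Ioi (0 : ℝ),
        (μ (Metric.thickening (ε n) {x | t < u x}) - μ {x | t < u x}) / ENNReal.ofReal (ε n))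
          atTop :=
        lintegral_liminf_le fun n => (hdm n).div_const _
    _ = liminf (fun n => ∫⁻ x, ENNReal.ofReal (supConv u (ε n) x - u x) /
          ENNReal.ofReal (ε n) ∂μ) atTop := by simp_rw [hlc]
    _ ≤ limsup (fun n => ∫⁻ x, ENNReal.ofReal (supConv u (ε n) x - u x) /
          ENNReal.ofReal (ε n) ∂μ) atTop := liminf_le_limsup
    _ ≤ ∫⁻ x, limsup (fun n => ENNReal.ofReal (supConv u (ε n) x - u x) /
          ENNReal.ofReal (ε n)) atTop ∂μ :=
        limsup_lintegral_le (fun _ => (K : ℝ≥0∞))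
          (fun n => (hHum n).ennreal_ofReal.div_const _)
          (fun n => Eventually.of_forall (hbound n)) (by simp)
    _ ≤ ∫⁻ x, gradMod u x ∂μ := lintegral_mono fun x => limsup_supConv_le hε hε0 x

end Coarea

/-! ### Isoperimetric estimates between two levels -/

/-- For `s ≤ t ≤ 1/2` the point `t` lies between `s` and `1 - s`, where `I` takes equal values;
concavity gives the claim with both endpoints included. -/
theorem IsProfileShape.monotoneOn_Icc {I : ℝ → ℝ} (hI : IsProfileShape I) :
    MonotoneOn I (Icc 0 (1 / 2)) := by
  intro s hs t ht hst
  have hs1 : s ∈ Icc (0 : ℝ) 1 := ⟨hs.1, by linarith [hs.2]⟩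
  have := hI.concave.min_le_of_mem_Icc hs1 (y := 1 - s) ⟨by linarith [hs1.2], by linarith [hs1.1]⟩
    (z := t) ⟨hst, by linarith [hs.2, ht.2]⟩
  rwa [hI.symmetric s hs1, min_self] at this

theorem measureReal_le_half {Ω : Type*} [MeasurableSpace Ω] {μ : Measure Ω} {A : Set Ω}
    (hA : μ A ≤ 1 / 2) : μ.real A ≤ 1 / 2 := by
  have := ENNReal.toReal_mono (by simp) hA
  simpa [measureReal_def] using this

/-- Distance cut-off of height `M` and slope `K`. -/
theorem lipschitzWith_cutoff {Ω : Type*} [MetricSpace Ω] (x₀ : Ω) (M : ℝ) (K : ℝ≥0) :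
    LipschitzWith K fun x : Ω => max (M - K * dist x x₀) 0 := by
  refine LipschitzWith.max_const (LipschitzWith.of_dist_le_mul fun x y => ?_) 0
  rw [Real.dist_eq, show M - K * dist x x₀ - (M - K * dist y x₀) =
    K * (dist y x₀ - dist x x₀) by ring, abs_mul, abs_of_nonneg K.coe_nonneg, dist_comm x y]
  gcongr
  exact abs_dist_sub_le y x x₀

section Levels

variable {Ω : Type*} [MetricSpace Ω] [MeasurableSpace Ω] {μ : Measure Ω} [IsProbabilityMeasure μ]

theorem IsIsoperimetricEstimator.ofReal_le_perimeter {I : ℝ → ℝ}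
    (hI : IsIsoperimetricEstimator μ I) {A : Set Ω} (hA : MeasurableSet A) :
    ENNReal.ofReal (I (μ.real A)) ≤ perimeter μ A := by
  refine (hI.2 _ ⟨measureReal_nonneg, measureReal_le_one⟩).trans ?_
  exact iInf_le_of_le A (iInf₂_le_of_le hA (by simp) le_rfl)

theorem lipschitzWith_clamp (a b : ℝ) : LipschitzWith 1 fun s : ℝ => min (max (s - a) 0) (b - a) :=
  ((LipschitzWith.of_dist_le_mul fun s t => by simp).max_const 0).min_const _

theorem edist_min_min_le (a b c d : ℝ) :
    edist (min a c) (min b d) ≤ edist a b + edist c d := by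
  rw [edist_dist, edist_dist, edist_dist, ← ENNReal.ofReal_add dist_nonneg dist_nonneg]
  refine ENNReal.ofReal_le_ofReal ((abs_min_sub_min_le_max _ _ _ _).trans ?_)
  exact max_le_add_of_nonneg (abs_nonneg _) (abs_nonneg _)

variable [BorelSpace Ω]

/-- The isoperimetric inequality integrated between the levels `a` and `b`. -/
theorem ofReal_mul_profile_le_lintegral (hgrad : GradientVanishesOnLevelSets μ) {I : ℝ → ℝ}
    (hI : IsIsoperimetricEstimator μ I) {g : Ω → ℝ} (hg : IsLipOnBalls g) {a b : ℝ} (hab : a < b)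
    (hmed : μ {x | a < g x} ≤ 1 / 2) :
    ENNReal.ofReal (b - a) * ENNReal.ofReal (I (μ.real {x | b < g x})) ≤
      ∫⁻ x in {x | a < g x ∧ g x ≤ b}, gradMod g x ∂μ := by
  obtain ⟨x₀⟩ := μ.nonempty_of_neZero
  have hgm := hg.continuous.measurable
  have hL : 0 < b - a := sub_pos.2 hab
  set h : Ω → ℝ := fun x => min (max (g x - a) 0) (b - a) with hh
  have hlip : IsLipOnBalls h := hg.comp_lipschitz (lipschitzWith_clamp a b)
  -- Off the slab, `h` takes one of the values `0` and `b - a`, and its gradient vanishes a.e. on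
  -- those two level sets.
  have hgradh : ∫⁻ x, gradMod h x ∂μ ≤ ∫⁻ x in {x | a < g x ∧ g x ≤ b}, gradMod g x ∂μ := by
    have hSm : MeasurableSet {x | a < g x ∧ g x ≤ b} :=
      (measurableSet_lt measurable_const hgm).inter (measurableSet_le hgm measurable_const)
    rw [← lintegral_indicator hSm]
    refine lintegral_mono_ae ?_
    filter_upwards [hgrad h hlip 0, hgrad h hlip (b - a)] with x h0 h1
    by_cases hx : a < g x ∧ g x ≤ b
    · rw [indicator_of_mem (by exact hx)]
      exact gradMod_comp_le (lipschitzWith_clamp a b) g x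
    · rcases not_and_or.1 hx with hx | hx
      · rw [h0 (by simp only [hh]; rw [max_eq_right (by linarith), min_eq_left hL.le])]
        exact zero_le
      · rw [h1 (by simp only [hh]; rw [max_eq_left (by linarith), min_eq_right (by linarith)])]
        exact zero_le
  -- The co-area inequality requires bounded support. With this slope the cut-off of height `2 (b -
  -- a)` is at least `b - a` on the ball of radius `n + 1` and vanishes beyond `2 (n + 1)`; the
  -- slope, hence the added gradient, tends to `0`.
  set K : ℕ → ℝ≥0 := fun n => Real.toNNReal ((b - a) / ((n : ℝ) + 1)) with hKdef
  have hK : ∀ n, (K n : ℝ) = (b - a) / ((n : ℝ) + 1) := fun n =>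
    Real.coe_toNNReal _ (by positivity)
  set ψ : ℕ → Ω → ℝ := fun n x => max (2 * (b - a) - K n * dist x x₀) 0 with hψ
  have hψl : ∀ n, LipschitzWith (K n) (ψ n) := fun n => lipschitzWith_cutoff x₀ _ _
  set u : ℕ → Ω → ℝ := fun n x => min (h x) (ψ n x) with hu
  have hed : ∀ n x y, edist (u n x) (u n y) ≤ edist (h x) (h y) + K n * edist x y := fun n x y =>
    (edist_min_min_le _ _ _ _).trans (by gcongr; exact hψl n x y)
  have hulip : ∀ n, IsLipOnBalls (u n) := fun n x r => by
    obtain ⟨C, hC⟩ := hlip x r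
    refine ⟨C + K n, fun y hy z hz => (hed n y z).trans ?_⟩
    rw [ENNReal.coe_add, add_mul]
    gcongr
    exact hC hy hz
  set S : ℕ → Set Ω := fun n => {x | b < g x} ∩ Metric.ball x₀ ((n : ℝ) + 1) with hS
  have hstep : ∀ n, ENNReal.ofReal (b - a) * ENNReal.ofReal (I (μ.real (S n))) ≤
      ∫⁻ x in {x | a < g x ∧ g x ≤ b}, gradMod g x ∂μ + K n := by
    intro n
    have hn : (0 : ℝ) < (n : ℝ) + 1 := by positivity
    calc _ ≤ ∫⁻ x, gradMod (u n) x ∂μ := by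
          refine ofReal_mul_le_lintegral_gradMod μ (hulip n) (x₀ := x₀) (R := 2 * ((n : ℝ) + 1))
            (fun x => le_min (le_min (le_max_right _ _) hL.le) (le_max_right _ _))
            (fun x => (min_le_left _ _).trans (min_le_right _ _)) (fun x hx => ?_) fun t ht => ?_
          · have h1 : 2 * (b - a) ≤ K n * dist x x₀ := by
              calc 2 * (b - a) = (b - a) / ((n : ℝ) + 1) * (2 * ((n : ℝ) + 1)) := by field_simp
                _ ≤ _ := by rw [hK]; gcongr
            simp only [hu, hψ]
            rw [max_eq_right (by linarith)]
            exact min_eq_right (le_min (le_max_right _ _) hL.le)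
          · refine le_trans (ENNReal.ofReal_le_ofReal ?_) (hI.ofReal_le_perimeter
              (measurableSet_lt measurable_const (hulip n).continuous.measurable))
            have hsub : {x | t < u n x} ⊆ {x | a < g x} := by
              intro x (hx : t < u n x)
              have h2 : 0 < max (g x - a) 0 :=
                ht.1.trans (hx.trans_le ((min_le_left _ _).trans (min_le_left _ _)))
              exact (by simpa using h2 : a < g x)
            have hsup : S n ⊆ {x | t < u n x} := by
              rintro x ⟨hx : b < g x, hxb⟩
              have h1 : K n * dist x x₀ ≤ b - a := by
                calc K n * dist x x₀ ≤ (b - a) / ((n : ℝ) + 1) * ((n : ℝ) + 1) := by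
                      rw [hK]; gcongr; exact (Metric.mem_ball.1 hxb).le
                  _ = _ := by field_simp
              refine lt_min (lt_min (lt_max_of_lt_left ?_) ht.2) (lt_max_of_lt_left ?_) <;>
                linarith [ht.2]
            -- `S n ⊆ {u n > t} ⊆ {g > a}` keeps both measures in `[0, 1/2]`, where `I` is monotone.
            exact hI.1.monotoneOn_Icc
              ⟨measureReal_nonneg, measureReal_le_half
                ((measure_mono (hsup.trans hsub)).trans hmed)⟩
              ⟨measureReal_nonneg, measureReal_le_half ((measure_mono hsub).trans hmed)⟩
              (measureReal_mono hsup)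
      _ ≤ ∫⁻ x, (gradMod h x + K n) ∂μ :=
          lintegral_mono fun x => gradMod_le_of_forall_edist_le (hed n x)
      _ = ∫⁻ x, gradMod h x ∂μ + K n := by
          rw [lintegral_add_right _ measurable_const]; simp
      _ ≤ _ := by gcongr
  have hSlim : Tendsto (fun n => μ.real (S n)) atTop (𝓝 (μ.real {x | b < g x})) := by
    have hU : ⋃ n, S n = {x | b < g x} := by
      rw [hS, ← inter_iUnion]
      refine inter_eq_left.2 fun x _ => mem_iUnion.2 ?_
      obtain ⟨n, hn⟩ := exists_nat_gt (dist x x₀)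
      exact ⟨n, Metric.mem_ball.2 (by linarith)⟩
    have hmono : Monotone S := fun m n hmn => inter_subset_inter_right _
      (Metric.ball_subset_ball (by gcongr))
    have := tendsto_measure_iUnion_atTop (μ := μ) hmono
    rw [hU] at this
    exact (ENNReal.tendsto_toReal (measure_ne_top _ _)).comp this
  have hIlim : Tendsto (fun n => I (μ.real (S n))) atTop (𝓝 (I (μ.real {x | b < g x}))) :=
    (hI.1.continuous _ ⟨measureReal_nonneg, measureReal_le_one⟩).tendsto.comp
      (tendsto_nhdsWithin_iff.2 ⟨hSlim, Eventually.of_forall fun n =>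
        ⟨measureReal_nonneg, measureReal_le_one⟩⟩)
  have hKlim : Tendsto (fun n => (K n : ℝ≥0∞)) atTop (𝓝 0) := by
    have : Tendsto (fun n : ℕ => (b - a) / ((n : ℝ) + 1)) atTop (𝓝 0) := by
      have := (tendsto_one_div_add_atTop_nhds_zero_nat (𝕜 := ℝ)).const_mul (b - a)
      simpa [div_eq_mul_inv] using this
    simpa [hKdef, ENNReal.ofReal] using ENNReal.tendsto_ofReal this
  have := le_of_tendsto_of_tendsto'
    (ENNReal.Tendsto.const_mul (ENNReal.tendsto_ofReal hIlim) (Or.inr ENNReal.ofReal_ne_top))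
    (tendsto_const_nhds.add hKlim) hstep
  rwa [add_zero] at this

/-- Hölder on the slab `{a < g ≤ b}`, whose measure is at most that of `{g > a}`. -/
theorem mul_profile_le_rpow (hgrad : GradientVanishesOnLevelSets μ) {I : ℝ → ℝ}
    (hI : IsIsoperimetricEstimator μ I) {g : Ω → ℝ} (hg : IsLipOnBalls g) {a b : ℝ} (hab : a < b)
    (hmed : μ {x | a < g x} ≤ 1 / 2) {q : ℝ} (hq : 1 ≤ q) {E : ℝ} (hE0 : 0 ≤ E)
    (hE : ∫⁻ x in {x | a < g x ∧ g x ≤ b}, gradMod g x ^ q ∂μ ≤ ENNReal.ofReal E) :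
    (b - a) * I (μ.real {x | b < g x}) ≤ E ^ (1 / q) * μ.real {x | a < g x} ^ (1 - 1 / q) := by
  have hq0 : 0 < q := by linarith
  have hq1 : 0 ≤ 1 - 1 / q := sub_nonneg.2 ((div_le_one hq0).2 hq)
  have h1 := ofReal_mul_profile_le_lintegral hgrad hI hg hab hmed
  have h2 := eLpNorm'_le_eLpNorm'_mul_rpow_measure_univ
    (μ := μ.restrict {x | a < g x ∧ g x ≤ b}) one_pos hq
    (measurable_gradMod hg.continuous).aestronglyMeasurable
  simp only [eLpNorm', enorm_eq_self, ENNReal.rpow_one, div_one, Measure.restrict_apply_univ] at h2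
  have h3 : μ {x | a < g x ∧ g x ≤ b} ≤ ENNReal.ofReal (μ.real {x | a < g x}) := by
    rw [ofReal_measureReal]
    exact measure_mono fun x hx => hx.1
  have h4 : ENNReal.ofReal ((b - a) * I (μ.real {x | b < g x})) ≤
      ENNReal.ofReal (E ^ (1 / q) * μ.real {x | a < g x} ^ (1 - 1 / q)) := by
    rw [ENNReal.ofReal_mul (sub_pos.2 hab).le, ENNReal.ofReal_mul (by positivity),
      ← ENNReal.ofReal_rpow_of_nonneg hE0 (by positivity),
      ← ENNReal.ofReal_rpow_of_nonneg measureReal_nonneg hq1]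
    exact h1.trans (h2.trans (by gcongr))
  exact (ENNReal.ofReal_le_ofReal_iff (by positivity)).1 h4

end Levels

/-! ### Summation over dyadic levels -/

section Dyadic

variable {N : ℝ → ℝ}

/-- The one-step recursion, with `m₀`, `m₁` the measures above consecutive levels `s`, `2 s` and `E`
the energy between them. The dichotomy is whether the measure drops by a factor of at least `4 ^ (1
/ α)`. -/
theorem IsYoungFunction.rpow_level_le (hN : IsYoungFunction N) {α : ℝ} (hα : 0 < α)
    (hanti : AntitoneOn (fun t => N (t ^ α) / t) (Ioi 0)) {q c : ℝ} (hq : 1 ≤ q) (hc : 0 < c)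
    {m₀ m₁ s E : ℝ} (hs : 0 < s) (hm : 0 < m₁) (hm01 : m₁ ≤ m₀) (hE : 0 ≤ E)
    (hlev : s * (c * (m₁ ^ (1 - 1 / q) / youngInv N (1 / m₁))) ≤
      E ^ (1 / q) * m₀ ^ (1 - 1 / q)) :
    (2 * s / youngInv N (1 / m₁)) ^ q ≤ (2 * 4 ^ (1 / α) / c) ^ q * E +
      1 / 2 * (s / youngInv N (1 / m₀)) ^ q := by
  have hpos : ∀ t, 0 < t → 0 < N t := fun t => hN.pos_of_antitoneOn hα hanti
  have hm₀ : 0 < m₀ := hm.trans_le hm01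
  have hq0 : 0 < q := by linarith
  have hq1 : 0 ≤ 1 - 1 / q := sub_nonneg.2 ((div_le_one hq0).2 hq)
  have hq2 : 1 - 1 / q ≤ 1 := sub_le_self _ (by positivity)
  have hw₁ := (hN.youngInv_spec hpos (one_div_pos.2 hm)).1
  have hw₀ := (hN.youngInv_spec hpos (one_div_pos.2 hm₀)).1
  have hr := hN.youngInv_le_rpow_mul hα hanti (one_div_pos.2 hm₀)
    (one_div_le_one_div_of_le hm hm01)
  rw [div_div_div_eq, one_mul, mul_one] at hr
  set w₁ := youngInv N (1 / m₁)
  set w₀ := youngInv N (1 / m₀)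
  have h4 : (0 : ℝ) < 4 ^ (1 / α) := by positivity
  rcases le_total (m₁ * 4 ^ (1 / α)) m₀ with h | h
  -- Large drop: the threshold is chosen so that `N⁻¹` gains a factor `4`, which beats the doubling
  -- of `s` and leaves `1/2`.
  · have hle : (m₁ / m₀) ^ α ≤ 1 / 4 := by
      have h5 : m₁ / m₀ ≤ (4 ^ (1 / α))⁻¹ := by
        rw [div_le_iff₀ hm₀, inv_mul_eq_div, le_div_iff₀ h4]; exact h
      calc (m₁ / m₀) ^ α ≤ ((4 ^ (1 / α))⁻¹) ^ α := by gcongr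
        _ = 1 / 4 := by
          rw [Real.inv_rpow h4.le, ← Real.rpow_mul (by norm_num), one_div_mul_cancel hα.ne',
            Real.rpow_one, one_div]
    have h6 : 2 * s / w₁ ≤ 1 / 2 * (s / w₀) := by
      rw [div_le_iff₀ hw₁]
      have h7 : w₀ ≤ 1 / 4 * w₁ := hr.trans (by gcongr)
      have h8 : s ≤ s / w₀ * (1 / 4 * w₁) := by
        calc s = s / w₀ * w₀ := by field_simp
          _ ≤ _ := by gcongr
      linarith
    calc (2 * s / w₁) ^ q ≤ (1 / 2 * (s / w₀)) ^ q := by gcongr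
      _ = (1 / 2) ^ q * (s / w₀) ^ q := Real.mul_rpow (by norm_num) (by positivity)
      _ ≤ (1 / 2) ^ (1 : ℝ) * (s / w₀) ^ q := by
        gcongr ?_ * _
        exact Real.rpow_le_rpow_of_exponent_ge (by norm_num) (by norm_num) hq
      _ ≤ _ := by
        rw [Real.rpow_one]
        have : 0 ≤ (2 * 4 ^ (1 / α) / c) ^ q * E := by positivity
        linarith
  -- Small drop: the measures are comparable, so the level inequality alone bounds the new term by
  -- the energy.
  · have h5 : (m₀ / m₁) ^ (1 - 1 / q) ≤ 4 ^ (1 / α) := by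
      calc (m₀ / m₁) ^ (1 - 1 / q) ≤ (m₀ / m₁) ^ (1 : ℝ) :=
            Real.rpow_le_rpow_of_exponent_le ((one_le_div hm).2 hm01) hq2
        _ ≤ _ := by rw [Real.rpow_one, div_le_iff₀ hm]; linarith
    have h6 : 2 * s / w₁ ≤ 2 * 4 ^ (1 / α) / c * E ^ (1 / q) := by
      have h7 : s * c / w₁ ≤ E ^ (1 / q) * (m₀ / m₁) ^ (1 - 1 / q) := by
        rw [Real.div_rpow hm₀.le hm.le, mul_div_assoc', le_div_iff₀ (by positivity)]
        calc _ = s * (c * (m₁ ^ (1 - 1 / q) / w₁)) := by ring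
          _ ≤ _ := hlev
      have h8 : s * c / w₁ ≤ E ^ (1 / q) * 4 ^ (1 / α) := h7.trans (by gcongr)
      calc 2 * s / w₁ = 2 / c * (s * c / w₁) := by field_simp
        _ ≤ 2 / c * (E ^ (1 / q) * 4 ^ (1 / α)) := by gcongr
        _ = _ := by ring
    calc (2 * s / w₁) ^ q ≤ (2 * 4 ^ (1 / α) / c * E ^ (1 / q)) ^ q := by gcongr
      _ = (2 * 4 ^ (1 / α) / c) ^ q * E := by
        rw [Real.mul_rpow (by positivity) (by positivity), ← Real.rpow_mul hE,
          one_div_mul_cancel hq0.ne', Real.rpow_one]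
      _ ≤ _ := le_add_of_nonneg_right (by positivity)

/-- The extra `x n` on the left makes the induction close: it pays for the term `1 / 2 * x n` of the
next step, doubled. -/
theorem sum_le_of_le_add_half {x e : ℕ → ℝ} {A : ℝ}
    (h : ∀ n, x (n + 1) ≤ A * e n + 1 / 2 * x n) (n : ℕ) :
    ∑ i ∈ Finset.range (n + 1), x i + x n ≤ 2 * (A * ∑ i ∈ Finset.range n, e i) + 2 * x 0 := by
  induction n with
  | zero => simp; linarith
  | succ n ih =>
    rw [Finset.sum_range_succ, Finset.sum_range_succ e n, mul_add]
    linarith [h n]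

/-- A summability bound over `ℤ` from a one-step recursion and decay at `-∞`. -/
theorem sum_le_of_recursion {x e : ℤ → ℝ} {A B : ℝ} (hA : 0 ≤ A) (hx : ∀ k, 0 ≤ x k)
    (hstep : ∀ k, x (k + 1) ≤ A * e k + 1 / 2 * x k) (he : ∀ F : Finset ℤ, ∑ k ∈ F, e k ≤ B)
    (hlim : Tendsto (fun n : ℕ => x (-n)) atTop (𝓝 0)) (F : Finset ℤ) :
    ∑ k ∈ F, x k ≤ 2 * (A * B) := by
  have hF : ∀ᶠ n : ℕ in atTop, ∑ k ∈ F, x k ≤ 2 * (A * B) + 2 * x (-n) := by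
    obtain ⟨M, hM⟩ : ∃ M : ℕ, ∀ k ∈ F, k.natAbs ≤ M := ⟨F.sup Int.natAbs, fun k hk =>
      Finset.le_sup (f := Int.natAbs) hk⟩
    filter_upwards [eventually_ge_atTop M] with n hn
    -- The recursion is started at `-n` and run to `n`, a window containing `F`; the initial term `x
    -- (-n)` disappears in the limit.
    have h1 := sum_le_of_le_add_half (x := fun i : ℕ => x (i - n)) (e := fun i : ℕ => e (i - n))
      (A := A) (fun i => by
        have := hstep (i - n)
        rwa [show (i : ℤ) - n + 1 = ((i + 1 : ℕ) : ℤ) - n by push_cast; ring] at this) (2 * n)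
    have hinj : Function.Injective fun i : ℕ => (i : ℤ) - n := fun i j hij => by
      simpa using hij
    have hmap : ∀ (y : ℤ → ℝ) (m : ℕ), ∑ i ∈ Finset.range m, y (i - n) =
        ∑ k ∈ (Finset.range m).image (fun i : ℕ => (i : ℤ) - n), y k :=
      fun y m => (Finset.sum_image hinj.injOn).symm
    have h2 : ∑ k ∈ F, x k ≤ ∑ i ∈ Finset.range (2 * n + 1), x (i - n) := by
      rw [hmap]
      refine Finset.sum_le_sum_of_subset_of_nonneg (fun k hk => ?_) fun k _ _ => hx k
      have := hM k hk
      exact Finset.mem_image.2 ⟨(k + n).toNat, Finset.mem_range.2 (by omega), by omega⟩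
    have h3 : ∑ i ∈ Finset.range (2 * n), e (i - n) ≤ B := by
      rw [hmap]
      exact he _
    have h4 := hx ((2 * n : ℕ) - n)
    have h5 : A * ∑ i ∈ Finset.range (2 * n), e (i - n) ≤ A * B := by gcongr
    simp only [Nat.cast_zero, zero_sub] at h1
    linarith
  have h0 : Tendsto (fun n : ℕ => 2 * (A * B) + 2 * x (-n)) atTop (𝓝 (2 * (A * B) + 2 * 0)) :=
    (hlim.const_mul 2).const_add _
  simpa using ge_of_tendsto h0 hF

end Dyadic

/-! ### The profile bound implies the Orlicz-Poincaré inequality -/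

theorem sum_toReal_setLIntegral_dyadic_le {Ω : Type*} [MeasurableSpace Ω]
    {μ : Measure Ω} {g : Ω → ℝ} (hg : Measurable g) {G : Ω → ℝ≥0∞} {D : ℝ}
    (hD : 0 ≤ D) (hE : ∫⁻ x, G x ∂μ ≤ ENNReal.ofReal D) (F : Finset ℤ) :
    ∑ k ∈ F, (∫⁻ x in {x | (2 : ℝ) ^ k < g x ∧ g x ≤ 2 ^ (k + 1)}, G x ∂μ).toReal ≤ D := by
  have hne : ∀ k : ℤ, ∫⁻ x in {x | (2 : ℝ) ^ k < g x ∧ g x ≤ 2 ^ (k + 1)}, G x ∂μ ≠ ∞ := fun k =>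
    ne_top_of_le_ne_top ENNReal.ofReal_ne_top ((setLIntegral_le_lintegral _ _).trans hE)
  have hdisj : Pairwise (Function.onFun Disjoint
      fun k : ℤ => {x | (2 : ℝ) ^ k < g x ∧ g x ≤ 2 ^ (k + 1)}) := by
    refine (pairwise_disjoint_on _).2 fun k l hkl => Set.disjoint_left.2 ?_
    rintro x ⟨-, h1⟩ ⟨h2, -⟩
    have : (2 : ℝ) ^ (k + 1) ≤ 2 ^ l := zpow_le_zpow_right₀ one_le_two hkl
    linarith
  rw [← ENNReal.toReal_sum fun k _ => hne k, ← lintegral_biUnion_finset (hdisj.set_pairwise _)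
    fun k _ => (measurableSet_lt measurable_const hg).inter (measurableSet_le hg measurable_const)]
  exact ENNReal.toReal_le_of_le_ofReal hD ((setLIntegral_le_lintegral _ _).trans hE)

section Sufficiency

variable {Ω : Type*} [MetricSpace Ω] [MeasurableSpace Ω] [BorelSpace Ω] {μ : Measure Ω}
  [IsProbabilityMeasure μ] {N : ℝ → ℝ}

/-- The modular estimate for a nonnegative function supported on at most half of the space. -/
theorem lintegral_young_le_half (hgrad : GradientVanishesOnLevelSets μ) {I : ℝ → ℝ}
    (hI : IsIsoperimetricEstimator μ I) (hN : IsYoungFunction N) {q : ℝ} (hq : 1 ≤ q)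
    (hmono : MonotoneOn (fun t => N t ^ (1 / q) / t) (Ioi 0)) {α : ℝ} (hα : 0 < α)
    (hanti : AntitoneOn (fun t => N (t ^ α) / t) (Ioi 0)) {c : ℝ} (hc : 0 < c)
    (hb : ∀ t ∈ Ioc (0 : ℝ) (1 / 2), c * (t ^ (1 - 1 / q) / youngInv N (1 / t)) ≤ I t)
    {g : Ω → ℝ} (hg : IsLipOnBalls g) (hg0 : ∀ x, 0 ≤ g x) (hmed : μ {x | 0 < g x} ≤ 1 / 2)
    {D : ℝ} (hD : 0 ≤ D) (hE : ∫⁻ x, gradMod g x ^ q ∂μ ≤ ENNReal.ofReal D) {v : ℝ} (hv : 0 < v)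
    (hvD : (2 / v) ^ q * (2 * ((2 * 4 ^ (1 / α) / c) ^ q * D)) ≤ 1 / 2) :
    ∫⁻ x, ENNReal.ofReal (N (g x / v)) ∂μ ≤ 1 / 2 := by
  have hpos : ∀ t, 0 < t → 0 < N t := fun t => hN.pos_of_antitoneOn hα hanti
  have hq0 : 0 < q := by linarith
  have hgm := hg.continuous.measurable
  have hinv0 : youngInv N 0 = 0 := by simpa [hN.zero] using hN.youngInv_apply hpos le_rfl
  have hlm : ∀ k : ℤ, MeasurableSet {x | (2 : ℝ) ^ k < g x} := fun k =>
    measurableSet_lt measurable_const hgm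
  set m : ℤ → ℝ := fun k => μ.real {x | (2 : ℝ) ^ k < g x} with hm
  have hm0 : ∀ k, 0 ≤ m k := fun k => measureReal_nonneg
  have hmeas : ∀ k : ℤ, μ {x | (2 : ℝ) ^ k < g x} ≤ 1 / 2 := fun k =>
    (measure_mono fun x (hx : (2 : ℝ) ^ k < g x) => lt_trans (by positivity) hx).trans hmed
  have hmhalf : ∀ k, m k ≤ 1 / 2 := fun k => measureReal_le_half (hmeas k)
  set x : ℤ → ℝ := fun k => ((2 : ℝ) ^ k / youngInv N (1 / m k)) ^ q with hx
  -- On empty levels `1 / 0 = 0`, `N⁻¹(0) = 0` and division by zero again give `x k = 0`, the value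
  -- that `N⁻¹(∞) = ∞` would give.
  have hx0 : ∀ k, m k = 0 → x k = 0 := fun k hk => by
    simp only [hx, hk, div_zero, hinv0, Real.zero_rpow hq0.ne']
  have hw : ∀ k, 0 < m k → 0 < youngInv N (1 / m k) ∧ N (youngInv N (1 / m k)) = 1 / m k :=
    fun k hk => hN.youngInv_spec hpos (one_div_pos.2 hk)
  have hxnn : ∀ k, 0 ≤ x k := fun k => by
    rcases (hm0 k).eq_or_lt with hk | hk
    · exact (hx0 k hk.symm).ge
    · have := (hw k hk).1
      positivity
  set e : ℤ → ℝ := fun k =>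
    (∫⁻ y in {y | (2 : ℝ) ^ k < g y ∧ g y ≤ 2 ^ (k + 1)}, gradMod g y ^ q ∂μ).toReal with he
  have hstep : ∀ k, x (k + 1) ≤ (2 * 4 ^ (1 / α) / c) ^ q * e k + 1 / 2 * x k := by
    intro k
    have he0 : 0 ≤ e k := ENNReal.toReal_nonneg
    have h2 : (2 : ℝ) ^ (k + 1) = 2 * 2 ^ k := by rw [zpow_add_one₀ two_ne_zero, mul_comm]
    have hk2 : (0 : ℝ) < 2 ^ k := by positivity
    rcases (hm0 (k + 1)).eq_or_lt with hk | hk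
    · rw [hx0 _ hk.symm]
      have := hxnn k
      positivity
    · have hlt : (2 : ℝ) ^ k < 2 ^ (k + 1) := by rw [h2]; linarith
      have hm01 : m (k + 1) ≤ m k := measureReal_mono fun y (hy : _ < g y) => hlt.trans hy
      have := mul_profile_le_rpow hgrad hI hg hlt (hmeas k) hq he0
        (ENNReal.ofReal_toReal (ne_top_of_le_ne_top ENNReal.ofReal_ne_top
          ((setLIntegral_le_lintegral _ _).trans hE))).ge
      rw [show (2 : ℝ) ^ (k + 1) - 2 ^ k = 2 ^ k by rw [h2]; ring] at this
      have hlev := (mul_le_mul_of_nonneg_left (hb _ ⟨hk, hmhalf _⟩) hk2.le).trans this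
      have := hN.rpow_level_le hα hanti hq hc hk2 hk hm01 he0 hlev
      rwa [← h2] at this
  have hw2 := (hN.youngInv_spec hpos (s := 2) two_pos).1
  -- Since `m k ≤ 1/2`, the denominators stay above `N⁻¹(2) > 0` while `2 ^ (-n)` tends to `0`.
  have hlim : Tendsto (fun n : ℕ => x (-n)) atTop (𝓝 0) := by
    have h1 : Tendsto (fun n : ℕ => ((1 / 2 : ℝ) ^ n / youngInv N 2) ^ q) atTop (𝓝 0) := by
      have := ((tendsto_pow_atTop_nhds_zero_of_lt_one (r := (1 / 2 : ℝ)) (by norm_num)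
        (by norm_num)).div_const (youngInv N 2)).rpow_const (p := q) (Or.inr hq0.le)
      rwa [zero_div, Real.zero_rpow hq0.ne'] at this
    refine squeeze_zero (fun n => hxnn _) (fun n => ?_) h1
    rcases (hm0 (-n)).eq_or_lt with hk | hk
    · rw [hx0 _ hk.symm]; positivity
    · have h3 : (2 : ℝ) ≤ 1 / m (-n) := by
        rw [le_div_iff₀ hk]; linarith [hmhalf (-n)]
      have h4 := hN.youngInv_le_youngInv hpos two_pos h3
      have h5 := (hw _ hk).1
      have h6 : (2 : ℝ) ^ (-(n : ℤ)) = (1 / 2) ^ n := by simp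
      simp only [hx, h6]
      gcongr
  have hsum : ∀ F : Finset ℤ, ∑ k ∈ F, x k ≤ 2 * ((2 * 4 ^ (1 / α) / c) ^ q * D) :=
    sum_le_of_recursion (by positivity) hxnn hstep
      (sum_toReal_setLIntegral_dyadic_le hgm hD hE) hlim
  have hvq : 0 ≤ (2 / v) ^ q := by positivity
  have hterm : ∀ k, N (2 ^ (k + 1) / v) * m k ≤ (2 / v) ^ q * x k := by
    intro k
    rcases (hm0 k).eq_or_lt with hk | hk
    · rw [← hk, hx0 k hk.symm]; simp
    · obtain ⟨hw0, hwN⟩ := hw k hk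
      set w := youngInv N (1 / m k) with hwdef
      have hl0 : 0 ≤ 2 / v * (2 ^ k / w) := by positivity
      have hlq : (2 / v * (2 ^ k / w)) ^ q = (2 / v) ^ q * x k :=
        Real.mul_rpow (by positivity) (by positivity)
      -- The `q`-th power of the left side is a single term of a sum bounded by `1/2`; this makes
      -- `map_mul_le_rpow` applicable.
      have hl1 : 2 / v * (2 ^ k / w) ≤ 1 := by
        by_contra! h
        have h1 := Real.one_lt_rpow h hq0
        have h2 := hsum {k}
        rw [Finset.sum_singleton] at h2
        have h3 := mul_le_mul_of_nonneg_left h2 hvq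
        linarith
      have := hN.map_mul_le_rpow hq0 hmono hl0 hl1 hw0
      rw [hlq, hwN, show 2 / v * (2 ^ k / w) * w = 2 ^ (k + 1) / v by
        rw [zpow_add_one₀ two_ne_zero]; field_simp] at this
      calc N (2 ^ (k + 1) / v) * m k ≤ (2 / v) ^ q * x k * (1 / m k) * m k := by gcongr
        _ = _ := by field_simp
  calc ∫⁻ y, ENNReal.ofReal (N (g y / v)) ∂μ
      ≤ ∫⁻ y, ∑' k : ℤ, {y | (2 : ℝ) ^ k < g y}.indicator
          (fun _ => ENNReal.ofReal (N (2 ^ (k + 1) / v))) y ∂μ := by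
        refine lintegral_mono fun y => ?_
        rcases (hg0 y).eq_or_lt with hy | hy
        · simp [← hy, hN.zero]
        · obtain ⟨k, hk1, hk2⟩ := exists_mem_Ioc_zpow hy one_lt_two
          refine le_trans ?_ (ENNReal.le_tsum k)
          rw [indicator_of_mem (by exact hk1)]
          refine ENNReal.ofReal_le_ofReal (hN.monotone ?_ ?_ (by gcongr))
          · exact mem_Ici.2 (by positivity)
          · exact mem_Ici.2 (by positivity)
    _ = ∑' k : ℤ, ENNReal.ofReal (N (2 ^ (k + 1) / v)) * μ {y | (2 : ℝ) ^ k < g y} := by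
        rw [lintegral_tsum fun k => (measurable_const.indicator (hlm k)).aemeasurable]
        simp_rw [lintegral_indicator_const (hlm _)]
    _ ≤ ∑' k : ℤ, ENNReal.ofReal ((2 / v) ^ q * x k) := by
        refine ENNReal.tsum_le_tsum fun k => ?_
        rw [← ofReal_measureReal, ← ENNReal.ofReal_mul (hN.nonneg (by positivity))]
        exact ENNReal.ofReal_le_ofReal (hterm k)
    _ ≤ ENNReal.ofReal (1 / 2) := by
        rw [ENNReal.tsum_eq_iSup_sum]
        refine iSup_le fun F => ?_
        rw [← ENNReal.ofReal_sum_of_nonneg fun k _ => mul_nonneg hvq (hxnn k), ← Finset.mul_sum]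
        exact ENNReal.ofReal_le_ofReal ((mul_le_mul_of_nonneg_left (hsum F) hvq).trans hvD)
    _ = 1 / 2 := by
        rw [ENNReal.ofReal_div_of_pos two_pos]; simp

theorem ProfileBound.orliczPoincare (hgrad : GradientVanishesOnLevelSets μ) {I : ℝ → ℝ}
    (hI : IsIsoperimetricEstimator μ I) (hN : IsYoungFunction N) {q : ℝ} (hq : 1 ≤ q)
    (hmono : MonotoneOn (fun t => N t ^ (1 / q) / t) (Ioi 0)) {α : ℝ} (hα : 0 < α)
    (hanti : AntitoneOn (fun t => N (t ^ α) / t) (Ioi 0)) (h : ProfileBound N q I) :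
    OrliczPoincare μ N q := by
  obtain ⟨c, hc, hb⟩ := h
  have hq0 : 0 < q := by linarith
  set A : ℝ := 2 * 4 ^ (1 / α) / c with hA
  have hA0 : 0 < A := by positivity
  -- With scale `v ≥ 8 A d`, `(2 / v) * (A d) ≤ 1/4`, so the modular is at most `2 (1/4)^q ≤ 1/2`
  -- for each of the positive and negative parts. The later `+ ε` keeps `v` positive when `d = 0`.
  refine ⟨8 * A, by positivity, fun f hf m hm => ?_⟩
  set Dn := eLpNorm (gradMod f) (ENNReal.ofReal q) μ with hDn
  rcases eq_or_ne Dn ∞ with htop | htop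
  · rw [htop, ENNReal.mul_top (by simpa using hA0)]; exact le_top
  refine ENNReal.le_of_forall_pos_le_add fun ε hε _ => ?_
  set d : ℝ := Dn.toReal with hd
  have hd0 : 0 ≤ d := ENNReal.toReal_nonneg
  have hDd : ENNReal.ofReal d = Dn := ENNReal.ofReal_toReal htop
  have hv : 0 < 8 * A * d + ε := by positivity
  have hε' : (0 : ℝ) < ε := hε
  have hlint : ∫⁻ x, gradMod f x ^ q ∂μ = ENNReal.ofReal (d ^ q) := by
    rw [← ENNReal.ofReal_rpow_of_nonneg hd0 hq0.le, hDd, hDn,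
      eLpNorm_eq_eLpNorm' (by simpa using hq0) ENNReal.ofReal_ne_top,
      ENNReal.toReal_ofReal hq0.le, eLpNorm', ← ENNReal.rpow_mul, one_div_mul_cancel hq0.ne',
      ENNReal.rpow_one]
    simp
  have hvD : (2 / (8 * A * d + ε)) ^ q * (2 * (A ^ q * d ^ q)) ≤ 1 / 2 := by
    have h1 : (2 / (8 * A * d + ε)) ^ q * (2 * (A ^ q * d ^ q)) =
        2 * (2 / (8 * A * d + ε) * (A * d)) ^ q := by
      rw [Real.mul_rpow (by positivity) (by positivity), Real.mul_rpow hA0.le hd0]; ring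
    have h2 : 2 / (8 * A * d + ε) * (A * d) ≤ 1 / 4 := by
      rw [div_mul_eq_mul_div, div_le_iff₀ hv]; linarith
    rw [h1]
    calc 2 * (2 / (8 * A * d + ε) * (A * d)) ^ q ≤ 2 * (1 / 4) ^ q := by gcongr
      _ ≤ 2 * (1 / 4) ^ (1 : ℝ) := by
        gcongr 2 * ?_
        exact Real.rpow_le_rpow_of_exponent_ge (by norm_num) (by norm_num) hq
      _ = 1 / 2 := by norm_num
  have key : ∀ g : Ω → ℝ, (∃ φ : ℝ → ℝ, LipschitzWith 1 φ ∧ (∀ s, 0 ≤ φ s) ∧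
      g = fun x => φ (f x)) → μ {x | 0 < g x} ≤ 1 / 2 →
      ∫⁻ x, ENNReal.ofReal (N (g x / (8 * A * d + ε))) ∂μ ≤ 1 / 2 := by
    rintro g ⟨φ, hφ, hφ0, rfl⟩ hmed
    refine lintegral_young_le_half hgrad hI hN hq hmono hα hanti hc hb (hf.comp_lipschitz hφ)
      (fun x => hφ0 _) hmed (D := d ^ q) (by positivity) (hlint ▸ lintegral_mono fun x => ?_) hv hvD
    gcongr
    exact gradMod_comp_le hφ f x
  have hfm := hf.continuous.measurable
  have hhalf : ∀ S : Set Ω, MeasurableSet S → 1 / 2 ≤ μ Sᶜ → μ S ≤ 1 / 2 := by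
    intro S hS h
    rw [prob_compl_eq_one_sub hS] at h
    have h2 : (1 : ℝ≥0∞) - 1 / 2 = 1 / 2 := by
      rw [one_div]; exact ENNReal.one_sub_inv_two
    calc μ S = 1 - (1 - μ S) := (ENNReal.sub_sub_cancel ENNReal.one_ne_top prob_le_one).symm
      _ ≤ 1 - 1 / 2 := by gcongr
      _ = 1 / 2 := h2
  have hpos := key (fun x => max (f x - m) 0) ⟨fun s => max (s - m) 0,
    (LipschitzWith.of_dist_le_mul fun s t => by simp).max_const 0, fun s => le_max_right _ _, rfl⟩
    (hhalf _ (measurableSet_lt measurable_const ((hfm.sub_const m).max measurable_const)) (by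
      convert hm.2 using 2; ext x; simp))
  have hneg := key (fun x => max (m - f x) 0) ⟨fun s => max (m - s) 0,
    (LipschitzWith.of_dist_le_mul fun s t => by rw [dist_sub_left, NNReal.coe_one, one_mul]).max_const 0,
      fun s => le_max_right _ _, rfl⟩
    (hhalf _ (measurableSet_lt measurable_const ((hfm.const_sub m).max measurable_const)) (by
      convert hm.1 using 2; ext x; simp))
  have htotal : ∫⁻ x, ENNReal.ofReal (N (|f x - m| / (8 * A * d + ε))) ∂μ ≤ 1 := by
    have hNm : Measurable fun x => ENNReal.ofReal (N (max (f x - m) 0 / (8 * A * d + ε))) := by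
      have h1 : Monotone fun s : ℝ => N (max s 0 / (8 * A * d + ε)) := fun s t hst =>
        hN.monotone (mem_Ici.2 (by positivity)) (mem_Ici.2 (by positivity)) (by gcongr)
      exact (h1.measurable.comp (hfm.sub_const m)).ennreal_ofReal
    calc _ = ∫⁻ x, (ENNReal.ofReal (N (max (f x - m) 0 / (8 * A * d + ε))) +
          ENNReal.ofReal (N (max (m - f x) 0 / (8 * A * d + ε)))) ∂μ := by
          refine lintegral_congr fun x => ?_
          rcases le_total m (f x) with h | h
          · rw [abs_of_nonneg (by linarith), max_eq_left (by linarith), max_eq_right (by linarith)]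
            simp [hN.zero]
          · rw [abs_of_nonpos (by linarith), max_eq_right (by linarith), max_eq_left (by linarith)]
            simp [hN.zero]
      _ ≤ 1 / 2 + 1 / 2 := by
          rw [lintegral_add_left hNm]; gcongr
      _ = 1 := ENNReal.add_halves 1
  refine (iInf_le_of_le (8 * A * d + ε) (iInf₂_le_of_le hv htotal le_rfl)).trans ?_
  rw [ENNReal.ofReal_add (by positivity) hε'.le, ENNReal.ofReal_mul (by positivity), hDd,
    ENNReal.ofReal_coe_nnreal]

end Sufficiency

/-! ### Equimeasurable functions -/

theorem measure_iUnion_le_of_forall_le {α : Type*} [MeasurableSpace α] {ν : Measure α}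
    {A : ℕ → Set α} (hA : Monotone A) {c : ℝ≥0∞} (h : ∀ n, ν (A n) ≤ c) : ν (⋃ n, A n) ≤ c := by
  rw [hA.measure_iUnion]
  exact iSup_le h

/-- The distribution function is right-continuous, so the infimum defining the rearrangement is
attained. -/
theorem rearr_le_iff {α : Type*} [MeasurableSpace α] {ν : Measure α} {f : α → ℝ≥0∞} {s : ℝ}
    {t : ℝ≥0∞} : rearr ν f s ≤ t ↔ ν {x | t < f x} ≤ ENNReal.ofReal s := by
  refine ⟨fun h => ?_, fun h => sInf_le h⟩
  rcases eq_or_ne t ∞ with rfl | ht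
  · simp
  obtain ⟨u, hu, hut, hlim⟩ := exists_seq_strictAnti_tendsto' (lt_top_iff_ne_top.2 ht)
  have hsub : {x | t < f x} ⊆ ⋃ n, {x | u n < f x} := fun x (hx : t < f x) => by
    obtain ⟨n, hn⟩ := (hlim.eventually (gt_mem_nhds hx)).exists
    exact mem_iUnion.2 ⟨n, hn⟩
  refine (measure_mono hsub).trans (measure_iUnion_le_of_forall_le
    (fun m n hmn x (hx : u m < f x) => (hu.antitone hmn).trans_lt hx) fun n => ?_)
  obtain ⟨w, hw, hwu⟩ := sInf_lt_iff.1 (h.trans_lt (hut n).1)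
  exact (measure_mono fun x (hx : u n < f x) => hwu.trans hx).trans hw

theorem measurable_rearr {α : Type*} [MeasurableSpace α] (ν : Measure α) (f : α → ℝ≥0∞) :
    Measurable (rearr ν f) :=
  Antitone.measurable fun _ _ hst => rearr_le_iff.2
    ((rearr_le_iff.1 le_rfl).trans (ENNReal.ofReal_le_ofReal hst))

theorem map_eq_map_of_measure_lt_eq {α β : Type*} [MeasurableSpace α] [MeasurableSpace β]
    {ν : Measure α} {ν' : Measure β} [IsProbabilityMeasure ν] [IsProbabilityMeasure ν']
    {f : α → ℝ≥0∞} {g : β → ℝ≥0∞} (hf : Measurable f) (hg : Measurable g)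
    (h : ∀ t, ν {x | t < f x} = ν' {x | t < g x}) : ν.map f = ν'.map g := by
  have := Measure.isProbabilityMeasure_map (μ := ν) hf.aemeasurable
  have := Measure.isProbabilityMeasure_map (μ := ν') hg.aemeasurable
  refine Measure.ext_of_Iic _ _ fun t => ?_
  rw [← compl_Ioi, prob_compl_eq_one_sub measurableSet_Ioi, prob_compl_eq_one_sub measurableSet_Ioi,
    Measure.map_apply hf measurableSet_Ioi, Measure.map_apply hg measurableSet_Ioi]
  congr 1
  exact h t

theorem map_eq_map_of_rearr_eq {α : Type*} [MeasurableSpace α] {ν : Measure α}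
    [IsProbabilityMeasure ν] {f g : α → ℝ≥0∞} (hf : Measurable f) (hg : Measurable g)
    (h : rearr ν f = rearr ν g) : ν.map f = ν.map g := by
  refine map_eq_map_of_measure_lt_eq hf hg fun t => le_antisymm ?_ ?_
  · rw [← ofReal_measureReal (s := {x | t < g x}), ← rearr_le_iff, h, rearr_le_iff,
      ofReal_measureReal]
  · rw [← ofReal_measureReal (s := {x | t < f x}), ← rearr_le_iff, ← h, rearr_le_iff,
      ofReal_measureReal]

instance isProbabilityMeasure_unitMeasure : IsProbabilityMeasure unitMeasure :=
  ⟨by simp [unitMeasure]⟩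

theorem unitMeasure_Ioo_zero {m : ℝ} (hm1 : m ≤ 1) : unitMeasure (Ioo 0 m) = ENNReal.ofReal m := by
  rw [unitMeasure, Measure.restrict_apply measurableSet_Ioo,
    inter_eq_left.2 (Ioo_subset_Ioo_right hm1), Real.volume_Ioo, sub_zero]

/-- Within `(0, 1)`, the set where the rearrangement exceeds `t` is the interval from `0` to `ν {f >
t}`. Equality of laws transfers every modular, so each Luxemburg space is represented by its
analogue on `(0, 1)`. -/
theorem map_rearr_unitMeasure {α : Type*} [MeasurableSpace α] {ν : Measure α}
    [IsProbabilityMeasure ν] {f : α → ℝ≥0∞} (hf : Measurable f) :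
    unitMeasure.map (rearr ν f) = ν.map f := by
  refine map_eq_map_of_measure_lt_eq (measurable_rearr ν f) hf fun t => ?_
  have h1 : ∀ s, t < rearr ν f s ↔ ENNReal.ofReal s < ν {x | t < f x} := fun s => by
    rw [← not_le, rearr_le_iff, not_le]
  have h2 : unitMeasure {s | t < rearr ν f s} = unitMeasure (Ioo 0 (ν.real {x | t < f x})) := by
    simp only [unitMeasure]
    rw [Measure.restrict_apply' measurableSet_Ioo, Measure.restrict_apply' measurableSet_Ioo]
    congr 1
    ext s
    refine and_congr_left fun hs => ?_
    simp only [mem_ofPred_eq, h1, mem_Ioo, hs.1, true_and]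
    rw [← ofReal_measureReal, ENNReal.ofReal_lt_ofReal_iff_of_nonneg hs.1.le]
  rw [h2, unitMeasure_Ioo_zero measureReal_le_one, ofReal_measureReal]

/-! ### The Luxemburg norm as a rearrangement invariant norm -/

/-- Extension of a Young function to `[0, ∞]`. -/
def youngExt (N : ℝ → ℝ) (x : ℝ≥0∞) : ℝ≥0∞ := if x = ∞ then ∞ else ENNReal.ofReal (N x.toReal)

/-- The Luxemburg norm of a function with values in `[0, ∞]`. -/
def eLuxNorm {α : Type*} [MeasurableSpace α] (N : ℝ → ℝ) (ν : Measure α) (f : α → ℝ≥0∞) : ℝ≥0∞ :=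
  ⨅ (v : ℝ) (_ : 0 < v) (_ : ∫⁻ x, youngExt N (f x / ENNReal.ofReal v) ∂ν ≤ 1), ENNReal.ofReal v

@[simp] theorem youngExt_top (N : ℝ → ℝ) : youngExt N ∞ = ∞ := if_pos rfl

theorem youngExt_of_ne_top (N : ℝ → ℝ) {x : ℝ≥0∞} (hx : x ≠ ∞) :
    youngExt N x = ENNReal.ofReal (N x.toReal) := if_neg hx

theorem youngExt_ofReal (N : ℝ → ℝ) {t : ℝ} (ht : 0 ≤ t) :
    youngExt N (ENNReal.ofReal t) = ENNReal.ofReal (N t) := by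
  rw [youngExt_of_ne_top N ENNReal.ofReal_ne_top, ENNReal.toReal_ofReal ht]

theorem youngExt_rpow {q : ℝ} (hq : 0 < q) (x : ℝ≥0∞) : youngExt (fun t => t ^ q) x = x ^ q := by
  rcases eq_or_ne x ∞ with rfl | hx
  · simp [hq]
  · rw [youngExt_of_ne_top _ hx, ← ENNReal.ofReal_rpow_of_nonneg ENNReal.toReal_nonneg hq.le,
      ENNReal.ofReal_toReal hx]

namespace IsYoungFunction

variable {N : ℝ → ℝ}

theorem youngExt_zero (hN : IsYoungFunction N) : youngExt N 0 = 0 := by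
  simp [youngExt, hN.zero]

theorem monotone_youngExt (hN : IsYoungFunction N) : Monotone (youngExt N) := by
  intro x y hxy
  rcases eq_or_ne y ∞ with rfl | hy
  · simp
  rw [youngExt_of_ne_top N hy, youngExt_of_ne_top N (ne_top_of_le_ne_top hy hxy)]
  exact ENNReal.ofReal_le_ofReal (hN.monotone ENNReal.toReal_nonneg ENNReal.toReal_nonneg
    (ENNReal.toReal_mono hy hxy))

theorem youngExt_add_le (hN : IsYoungFunction N) {a b : ℝ} (ha : 0 < a) (hb : 0 < b)
    (hab : a + b = 1) (x y : ℝ≥0∞) :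
    youngExt N (ENNReal.ofReal a * x + ENNReal.ofReal b * y) ≤
      ENNReal.ofReal a * youngExt N x + ENNReal.ofReal b * youngExt N y := by
  rcases eq_or_ne x ∞ with rfl | hx
  · rw [youngExt_top, ENNReal.mul_top (by simpa using ha), top_add]; exact le_top
  rcases eq_or_ne y ∞ with rfl | hy
  · rw [youngExt_top, ENNReal.mul_top (by simpa using hb), add_top, add_top]; exact le_top
  lift x to ℝ≥0 using hx
  lift y to ℝ≥0 using hy
  rw [← ENNReal.ofReal_coe_nnreal, ← ENNReal.ofReal_coe_nnreal, ← ENNReal.ofReal_mul ha.le,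
    ← ENNReal.ofReal_mul hb.le, ← ENNReal.ofReal_add (by positivity) (by positivity),
    youngExt_ofReal N (by positivity), youngExt_ofReal N x.coe_nonneg,
    youngExt_ofReal N y.coe_nonneg, ← ENNReal.ofReal_mul ha.le, ← ENNReal.ofReal_mul hb.le,
    ← ENNReal.ofReal_add (mul_nonneg ha.le (hN.nonneg x.coe_nonneg))
      (mul_nonneg hb.le (hN.nonneg y.coe_nonneg))]
  exact ENNReal.ofReal_le_ofReal (hN.convex.2 x.coe_nonneg y.coe_nonneg ha.le hb.le hab)

/-- A Young function grows at least linearly. -/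
theorem exists_le_youngExt (hN : IsYoungFunction N) :
    ∃ K : ℝ≥0, 0 < K ∧ ∀ x, x ≤ K * (1 + youngExt N x) := by
  obtain ⟨t, ht, hNt⟩ := hN.nontrivial
  refine ⟨Real.toNNReal (max t (t / N t)), by simpa using Or.inl ht, fun x => ?_⟩
  set K := max t (t / N t) with hK
  have hK0 : 0 < K := lt_max_of_lt_left ht
  rcases eq_or_ne x ∞ with rfl | hx
  · rw [youngExt_top, add_top, ENNReal.mul_top (by simpa using hK0)]
  lift x to ℝ≥0 using hx
  rw [← ENNReal.ofReal_coe_nnreal, youngExt_ofReal N x.coe_nonneg, ← ENNReal.ofReal_one,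
    ← ENNReal.ofReal_add zero_le_one (hN.nonneg x.coe_nonneg),
    show ((Real.toNNReal K : ℝ≥0) : ℝ≥0∞) = ENNReal.ofReal K from rfl, ← ENNReal.ofReal_mul hK0.le]
  refine ENNReal.ofReal_le_ofReal ?_
  have hNx := hN.nonneg x.coe_nonneg
  rcases le_total (x : ℝ) t with h | h
  · calc (x : ℝ) ≤ K := h.trans (le_max_left _ _)
      _ ≤ K * (1 + N x) := le_mul_of_one_le_right hK0.le (by linarith)
  · calc (x : ℝ) = t / N t * (x / t * N t) := by field_simp
      _ ≤ t / N t * N x := by gcongr; exact hN.mul_le_map ht h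
      _ ≤ K * N x := by gcongr; exact le_max_right _ _
      _ ≤ K * (1 + N x) := by gcongr; linarith

/-- Continuity of `N` handles a finite supremum, linear growth an infinite one. This feeds the Fatou
property of the norm. -/
theorem youngExt_iSup (hN : IsYoungFunction N) {x : ℕ → ℝ≥0∞} (hx : Monotone x) :
    youngExt N (⨆ n, x n) = ⨆ n, youngExt N (x n) := by
  have hmono : Monotone fun n => youngExt N (x n) := hN.monotone_youngExt.comp hx
  refine le_antisymm ?_ (iSup_le fun n => hN.monotone_youngExt (le_iSup x n))
  obtain ⟨K, hK0, hK⟩ := hN.exists_le_youngExt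
  rcases eq_or_ne (⨆ n, x n) ∞ with h | h
  · have h1 : (∞ : ℝ≥0∞) ≤ K * (1 + ⨆ n, youngExt N (x n)) := by
      rw [← h]
      refine iSup_le fun n => (hK _).trans ?_
      gcongr
      exact le_iSup (fun n => youngExt N (x n)) n
    by_contra! h2
    have h3 : (⨆ n, youngExt N (x n)) ≠ ∞ := h2.ne_top
    exact absurd (top_le_iff.1 h1) (by finiteness)
  · have hfin : ∀ n, x n ≠ ∞ := fun n => ne_top_of_le_ne_top h (le_iSup x n)
    have h1 : Tendsto (fun n => (x n).toReal) atTop (𝓝 (⨆ n, x n).toReal) :=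
      (ENNReal.tendsto_toReal h).comp (tendsto_atTop_iSup hx)
    have h2 : Tendsto (fun n => N (x n).toReal) atTop (𝓝 (N (⨆ n, x n).toReal)) :=
      (hN.continuousOn _ (mem_Ici.2 ENNReal.toReal_nonneg)).tendsto.comp
        (tendsto_nhdsWithin_iff.2 ⟨h1, Eventually.of_forall fun n => ENNReal.toReal_nonneg⟩)
    have h3 := ENNReal.tendsto_ofReal h2
    simp_rw [← youngExt_of_ne_top N (hfin _)] at h3
    rw [youngExt_of_ne_top N h, tendsto_nhds_unique h3 (tendsto_atTop_iSup hmono)]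

theorem measurable_modular (hN : IsYoungFunction N) {α : Type*} [MeasurableSpace α]
    {f : α → ℝ≥0∞} (hf : Measurable f) (v : ℝ≥0∞) : Measurable fun x => youngExt N (f x / v) :=
  hN.monotone_youngExt.measurable.comp (hf.div_const v)

end IsYoungFunction

section LuxemburgNorm

variable {α : Type*} [MeasurableSpace α] {ν : Measure α} {N : ℝ → ℝ} {f g : α → ℝ≥0∞}

theorem eLuxNorm_le {v : ℝ} (hv : 0 < v)
    (h : ∫⁻ x, youngExt N (f x / ENNReal.ofReal v) ∂ν ≤ 1) : eLuxNorm N ν f ≤ ENNReal.ofReal v :=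
  iInf_le_of_le v (iInf₂_le_of_le hv h le_rfl)

theorem le_eLuxNorm {a : ℝ≥0∞} (h : ∀ v : ℝ, 0 < v →
    ∫⁻ x, youngExt N (f x / ENNReal.ofReal v) ∂ν ≤ 1 → a ≤ ENNReal.ofReal v) :
    a ≤ eLuxNorm N ν f := le_iInf fun v => le_iInf₂ (h v)

theorem lintegral_youngExt_le_one_of_lt (hN : IsYoungFunction N) {v : ℝ}
    (h : eLuxNorm N ν f < ENNReal.ofReal v) :
    ∫⁻ x, youngExt N (f x / ENNReal.ofReal v) ∂ν ≤ 1 := by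
  simp only [eLuxNorm, iInf_lt_iff] at h
  obtain ⟨w, -, hw, hwv⟩ := h
  refine le_trans (lintegral_mono fun x => hN.monotone_youngExt ?_) hw
  gcongr

theorem eLuxNorm_mono_ae (hN : IsYoungFunction N) (h : f ≤ᵐ[ν] g) :
    eLuxNorm N ν f ≤ eLuxNorm N ν g := by
  refine le_eLuxNorm fun v hv hg => eLuxNorm_le hv (le_trans (lintegral_mono_ae ?_) hg)
  filter_upwards [h] with x hx
  refine hN.monotone_youngExt ?_
  gcongr

theorem eLuxNorm_congr_of_map_eq (hN : IsYoungFunction N) {β : Type*} [MeasurableSpace β]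
    {ν' : Measure β} {g : β → ℝ≥0∞} (hf : Measurable f) (hg : Measurable g)
    (h : ν.map f = ν'.map g) : eLuxNorm N ν f = eLuxNorm N ν' g := by
  have (v : ℝ≥0∞) : ∫⁻ x, youngExt N (f x / v) ∂ν = ∫⁻ x, youngExt N (g x / v) ∂ν' := by
    have hm : Measurable fun y : ℝ≥0∞ => youngExt N (y / v) := hN.measurable_modular measurable_id v
    rw [← lintegral_map hm hf, h, lintegral_map hm hg]
  simp only [eLuxNorm, this]

theorem eLuxNorm_zero (hN : IsYoungFunction N) : eLuxNorm N ν (fun _ => 0) = 0 := by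
  refine le_antisymm (ENNReal.le_of_forall_pos_le_add fun ε hε _ => ?_) zero_le
  rw [zero_add, ← ENNReal.ofReal_coe_nnreal]
  exact eLuxNorm_le (by exact_mod_cast hε) (by simp [hN.youngExt_zero])

theorem eLuxNorm_const_mul_le {c : ℝ≥0} (hc : 0 < c) (f : α → ℝ≥0∞) :
    eLuxNorm N ν (fun x => c * f x) ≤ c * eLuxNorm N ν f := by
  have hc0 : (c : ℝ≥0∞) ≠ 0 := by exact_mod_cast hc.ne'
  rw [← ENNReal.div_le_iff' hc0 ENNReal.coe_ne_top]
  refine le_eLuxNorm fun v hv h => ?_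
  rw [ENNReal.div_le_iff' hc0 ENNReal.coe_ne_top]
  have h1 : ENNReal.ofReal (c * v) = c * ENNReal.ofReal v := by
    rw [ENNReal.ofReal_mul c.coe_nonneg, ENNReal.ofReal_coe_nnreal]
  rw [← h1]
  refine eLuxNorm_le (mul_pos hc hv) ?_
  simp_rw [h1, ENNReal.mul_div_mul_left _ _ hc0 ENNReal.coe_ne_top]
  exact h

theorem eLuxNorm_const_mul (hN : IsYoungFunction N) (c : ℝ≥0) (f : α → ℝ≥0∞) :
    eLuxNorm N ν (fun x => c * f x) = c * eLuxNorm N ν f := by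
  rcases eq_zero_or_pos c with rfl | hc
  · simp [eLuxNorm_zero hN]
  refine le_antisymm (eLuxNorm_const_mul_le hc f) ?_
  have h := eLuxNorm_const_mul_le (N := N) (ν := ν) (inv_pos.2 hc) fun x => c * f x
  have h1 : ((c⁻¹ : ℝ≥0) : ℝ≥0∞) * c = 1 := by
    rw [← ENNReal.coe_mul, inv_mul_cancel₀ hc.ne', ENNReal.coe_one]
  simp_rw [← mul_assoc, h1, one_mul] at h
  calc _ ≤ (c : ℝ≥0∞) * ((c⁻¹ : ℝ≥0) * eLuxNorm N ν fun x => c * f x) := by gcongr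
    _ = _ := by rw [← mul_assoc, mul_comm (c : ℝ≥0∞), h1, one_mul]

/-- For admissible scales `v`, `w`, the function `(f + g) / (v + w)` is the convex combination of `f
/ v` and `g / w` with weights `v / (v + w)` and `w / (v + w)`. -/
theorem eLuxNorm_add_le (hN : IsYoungFunction N) (hf : Measurable f) (g : α → ℝ≥0∞) :
    eLuxNorm N ν (fun x => f x + g x) ≤ eLuxNorm N ν f + eLuxNorm N ν g := by
  refine ENNReal.le_of_forall_pos_le_add fun ε hε hlt => ?_
  have hfin : ∀ {a : ℝ≥0∞}, a ≠ ∞ → a < ENNReal.ofReal (a.toReal + ε / 2) := fun {a} ha => by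
    rw [ENNReal.lt_ofReal_iff_toReal_lt ha]
    have : (0 : ℝ) < ε := hε
    linarith
  have hε' : (0 : ℝ) < ε := hε
  have hf1 : eLuxNorm N ν f ≠ ∞ := (ENNReal.add_lt_top.1 hlt).1.ne
  have hg1 : eLuxNorm N ν g ≠ ∞ := (ENNReal.add_lt_top.1 hlt).2.ne
  have hfv := lintegral_youngExt_le_one_of_lt hN (hfin hf1)
  have hgv := lintegral_youngExt_le_one_of_lt hN (hfin hg1)
  set v := (eLuxNorm N ν f).toReal + ε / 2 with hvdef
  set w := (eLuxNorm N ν g).toReal + ε / 2 with hwdef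
  have hv : 0 < v := by positivity
  have hw : 0 < w := by positivity
  have hvw : eLuxNorm N ν f + eLuxNorm N ν g + ε = ENNReal.ofReal (v + w) := by
    rw [show v + w = (eLuxNorm N ν f).toReal + (eLuxNorm N ν g).toReal + ε by
      rw [hvdef, hwdef]; ring, ENNReal.ofReal_add (by positivity) (by positivity),
      ENNReal.ofReal_add (by positivity) (by positivity), ENNReal.ofReal_toReal hf1,
      ENNReal.ofReal_toReal hg1, ENNReal.ofReal_coe_nnreal]
  rw [hvw]
  have hsplit : ∀ {u : ℝ} (_ : 0 < u) (y : ℝ≥0∞), y / ENNReal.ofReal (v + w) =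
      ENNReal.ofReal (u / (v + w)) * (y / ENNReal.ofReal u) := fun {u} hu y => by
    have h1 : ENNReal.ofReal u * (ENNReal.ofReal u)⁻¹ = 1 :=
      ENNReal.mul_inv_cancel (by simpa using hu) ENNReal.ofReal_ne_top
    rw [ENNReal.ofReal_div_of_pos (by positivity), div_eq_mul_inv, div_eq_mul_inv, div_eq_mul_inv,
      mul_mul_mul_comm, mul_comm _ y, mul_assoc, mul_comm (ENNReal.ofReal u),
      mul_assoc, mul_comm _ (ENNReal.ofReal u), h1, mul_one]
  refine eLuxNorm_le (by positivity) ?_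
  have ha : 0 < v / (v + w) := by positivity
  have hb : 0 < w / (v + w) := by positivity
  have hab : v / (v + w) + w / (v + w) = 1 := by field_simp
  calc ∫⁻ x, youngExt N ((f x + g x) / ENNReal.ofReal (v + w)) ∂ν
      ≤ ∫⁻ x, (ENNReal.ofReal (v / (v + w)) * youngExt N (f x / ENNReal.ofReal v) +
        ENNReal.ofReal (w / (v + w)) * youngExt N (g x / ENNReal.ofReal w)) ∂ν := by
        refine lintegral_mono fun x => ?_
        rw [ENNReal.add_div, hsplit hv, hsplit hw]
        exact hN.youngExt_add_le ha hb hab _ _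
    _ = ENNReal.ofReal (v / (v + w)) * ∫⁻ x, youngExt N (f x / ENNReal.ofReal v) ∂ν +
        ENNReal.ofReal (w / (v + w)) * ∫⁻ x, youngExt N (g x / ENNReal.ofReal w) ∂ν := by
        rw [lintegral_add_left ((hN.measurable_modular hf _).const_mul _),
          lintegral_const_mul' _ _ ENNReal.ofReal_ne_top,
          lintegral_const_mul' _ _ ENNReal.ofReal_ne_top]
    _ ≤ ENNReal.ofReal (v / (v + w)) * 1 + ENNReal.ofReal (w / (v + w)) * 1 := by gcongr
    _ = 1 := by
        rw [mul_one, mul_one, ← ENNReal.ofReal_add ha.le hb.le, hab, ENNReal.ofReal_one]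

theorem eLuxNorm_iSup (hN : IsYoungFunction N) {F : ℕ → α → ℝ≥0∞} (hF : ∀ n, Measurable (F n))
    (hmono : Monotone F) :
    eLuxNorm N ν (fun x => ⨆ n, F n x) = ⨆ n, eLuxNorm N ν (F n) := by
  refine le_antisymm ?_ (iSup_le fun n => eLuxNorm_mono_ae hN
    (Eventually.of_forall fun x => le_iSup (fun n => F n x) n))
  refine le_of_forall_gt fun c hc => ?_
  obtain ⟨v, hv, hvc⟩ := ENNReal.lt_iff_exists_nnreal_btwn.1 hc
  refine lt_of_le_of_lt ?_ hvc
  rw [← ENNReal.ofReal_coe_nnreal] at hv ⊢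
  have hv0 : (0 : ℝ) < v := by simpa using pos_of_gt hv
  refine eLuxNorm_le hv0 ?_
  have h1 : ∀ x, youngExt N ((⨆ n, F n x) / ENNReal.ofReal v) =
      ⨆ n, youngExt N (F n x / ENNReal.ofReal v) := fun x => by
    rw [ENNReal.iSup_div, hN.youngExt_iSup]
    intro m n hmn
    dsimp only
    gcongr
    exact hmono hmn x
  simp_rw [h1]
  rw [lintegral_iSup (fun n => hN.measurable_modular (hF n) _)]
  · exact iSup_le fun n => lintegral_youngExt_le_one_of_lt hN
      ((le_iSup (fun n => eLuxNorm N ν (F n)) n).trans_lt hv)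
  · intro m n hmn x
    refine hN.monotone_youngExt ?_
    gcongr
    exact hmono hmn x

theorem exists_lintegral_le_eLuxNorm (hN : IsYoungFunction N) (ν : Measure α)
    [IsProbabilityMeasure ν] : ∃ C : ℝ≥0, ∀ f, Measurable f → ∫⁻ x, f x ∂ν ≤ C * eLuxNorm N ν f := by
  obtain ⟨K, hK0, hK⟩ := hN.exists_le_youngExt
  refine ⟨2 * K, fun f hf => ?_⟩
  have hc0 : ((2 * K : ℝ≥0) : ℝ≥0∞) ≠ 0 := by
    have : 2 * K ≠ 0 := by positivity
    exact_mod_cast this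
  rw [← ENNReal.div_le_iff' hc0 ENNReal.coe_ne_top]
  refine le_eLuxNorm fun v hv h => ?_
  rw [ENNReal.div_le_iff' hc0 ENNReal.coe_ne_top]
  have hv0 : ENNReal.ofReal v ≠ 0 := by simpa using hv
  calc ∫⁻ x, f x ∂ν = ∫⁻ x, ENNReal.ofReal v * (f x / ENNReal.ofReal v) ∂ν := by
        simp_rw [ENNReal.mul_div_cancel hv0 ENNReal.ofReal_ne_top]
    _ ≤ ∫⁻ x, ENNReal.ofReal v * (K * (1 + youngExt N (f x / ENNReal.ofReal v))) ∂ν := by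
        gcongr; exact hK _
    _ = ENNReal.ofReal v * (K * (1 + ∫⁻ x, youngExt N (f x / ENNReal.ofReal v) ∂ν)) := by
        rw [lintegral_const_mul' _ _ ENNReal.ofReal_ne_top,
          lintegral_const_mul' _ _ ENNReal.coe_ne_top, lintegral_add_left measurable_const]
        simp
    _ ≤ ENNReal.ofReal v * (K * (1 + 1)) := by gcongr
    _ = _ := by push_cast; ring

theorem eLuxNorm_indicator_lt_top (hN : IsYoungFunction N) [IsProbabilityMeasure ν] (E : Set α) :
    eLuxNorm N ν (E.indicator fun _ => 1) < ∞ := by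
  set v := max 1 (N 1) with hv
  have hv1 : 1 ≤ v := le_max_left _ _
  have hv0 : 0 < v := by linarith
  refine (eLuxNorm_le hv0 ?_).trans_lt ENNReal.ofReal_lt_top
  have hb : youngExt N (1 / ENNReal.ofReal v) ≤ 1 := by
    rw [← ENNReal.ofReal_one, ← ENNReal.ofReal_div_of_pos hv0, youngExt_ofReal N (by positivity)]
    refine ENNReal.ofReal_le_ofReal ?_
    have := hN.map_mul_le (l := 1 / v) (by positivity) ((div_le_one hv0).2 hv1) zero_le_one
    rw [mul_one] at this
    refine this.trans ?_
    rw [one_div_mul_eq_div, div_le_one hv0]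
    exact le_max_right _ _
  calc _ ≤ ∫⁻ _, 1 ∂ν := by
        refine lintegral_mono fun x => le_trans (hN.monotone_youngExt ?_) hb
        gcongr
        exact indicator_le_self' (fun _ _ => zero_le) x
    _ = 1 := by simp

/-- The rearrangement invariant norm of the Orlicz space `L_N`. -/
def luxemburgRINorm {N : ℝ → ℝ} (hN : IsYoungFunction N) {α : Type*} [MeasurableSpace α]
    (ν : Measure α) [IsProbabilityMeasure ν] : RINorm ν where
  toFun := eLuxNorm N ν
  eq_zero_iff f hf := by
    refine ⟨fun h => ?_, fun h => ?_⟩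
    · obtain ⟨C, hC⟩ := exists_lintegral_le_eLuxNorm hN ν
      have := hC f hf
      rw [h, mul_zero, nonpos_iff_eq_zero, lintegral_eq_zero_iff hf] at this
      exact this
    · exact le_antisymm ((eLuxNorm_mono_ae hN h.le).trans (eLuxNorm_zero hN).le) zero_le
  homogeneous c f _ := eLuxNorm_const_mul hN c f
  triangle f g hf _ := eLuxNorm_add_le hN hf g
  mono _ _ _ _ h := eLuxNorm_mono_ae hN h
  fatou _ hF hmono := eLuxNorm_iSup hN hF hmono
  indicator_lt_top E _ _ := eLuxNorm_indicator_lt_top hN E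
  lintegral_le E _ _ := by
    obtain ⟨C, hC⟩ := exists_lintegral_le_eLuxNorm hN ν
    exact ⟨C, fun f hf => (setLIntegral_le_lintegral _ _).trans (hC f hf)⟩
  rearrangement_invariant _ _ hf hg h :=
    eLuxNorm_congr_of_map_eq hN hf hg (map_eq_map_of_rearr_eq hf hg h)

theorem represents_luxemburgRINorm (hN : IsYoungFunction N) (ν : Measure α)
    [IsProbabilityMeasure ν] :
    Represents (luxemburgRINorm hN ν) (luxemburgRINorm hN unitMeasure) := fun f hf =>
  eLuxNorm_congr_of_map_eq hN hf (measurable_rearr ν f) (map_rearr_unitMeasure hf).symm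

theorem eLuxNorm_ofReal_abs (N : ℝ → ℝ) (ν : Measure α) (f : α → ℝ) :
    eLuxNorm N ν (fun x => ENNReal.ofReal |f x|) = luxemburgNorm ν N f := by
  unfold eLuxNorm luxemburgNorm
  refine iInf_congr fun v => iInf_congr fun hv => ?_
  have : ∀ x, youngExt N (ENNReal.ofReal |f x| / ENNReal.ofReal v) =
      ENNReal.ofReal (N (|f x| / v)) := fun x => by
    rw [← ENNReal.ofReal_div_of_pos hv, youngExt_ofReal N (by positivity)]
  simp only [this]

/-- Lets the Luxemburg norm of `t ^ q` stand in for `L^q` in the Hardy property; this direction is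
the one needed there. -/
theorem eLpNorm_le_eLuxNorm_rpow {q : ℝ} (hq : 0 < q) (f : α → ℝ≥0∞) :
    eLpNorm f (ENNReal.ofReal q) ν ≤ eLuxNorm (fun t => t ^ q) ν f := by
  refine le_eLuxNorm fun v hv h => ?_
  have hv0 : ENNReal.ofReal v ≠ 0 := by simpa using hv
  rw [eLpNorm_eq_eLpNorm' (by simpa using hq) ENNReal.ofReal_ne_top, ENNReal.toReal_ofReal hq.le,
    eLpNorm', one_div, ENNReal.rpow_inv_le_iff hq]
  simp only [youngExt_rpow hq] at h
  calc ∫⁻ x, ‖f x‖ₑ ^ q ∂ν = ∫⁻ x, ENNReal.ofReal v ^ q * (f x / ENNReal.ofReal v) ^ q ∂ν := by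
        refine lintegral_congr fun x => ?_
        rw [← ENNReal.mul_rpow_of_nonneg _ _ hq.le, ENNReal.mul_div_cancel hv0
          ENNReal.ofReal_ne_top, enorm_eq_self]
    _ = ENNReal.ofReal v ^ q * ∫⁻ x, (f x / ENNReal.ofReal v) ^ q ∂ν :=
        lintegral_const_mul' _ _ (by finiteness)
    _ ≤ ENNReal.ofReal v ^ q * 1 := by gcongr
    _ = _ := mul_one _

end LuxemburgNorm

/-! ### Medians and the Poincaré inequality about the mean -/

section Median

variable {Ω : Type*} [MeasurableSpace Ω] {μ : Measure Ω} [IsProbabilityMeasure μ]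

theorem half_le_measure_of_compl {A : Set Ω} (hA : MeasurableSet A) (h : μ Aᶜ ≤ 1 / 2) :
    1 / 2 ≤ μ A := by
  by_contra! h1
  have h2 : μ A + μ Aᶜ = 1 := prob_add_prob_compl hA
  have h3 : μ A + μ Aᶜ < 1 / 2 + 1 / 2 :=
    ENNReal.add_lt_add_of_lt_of_le (measure_ne_top _ _) h1 h
  rw [ENNReal.add_halves, h2] at h3
  exact lt_irrefl _ h3

theorem not_forall_measure_le_half {A : ℕ → Set Ω} (hA : Monotone A) (hU : ⋃ n, A n = univ) :
    ¬ ∀ n, μ (A n) ≤ 1 / 2 := fun h => by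
  have := measure_iUnion_le_of_forall_le hA h
  rw [hU, measure_univ] at this
  exact absurd this (by rw [one_div]; exact not_le.2 ENNReal.one_half_lt_one)

theorem exists_isMedian {f : Ω → ℝ} (hf : Measurable f) : ∃ m, IsMedian μ f m := by
  -- The median is `sSup S`: approach from inside `S` bounds `μ {f < sSup S}`, approach from above,
  -- outside `S`, bounds `μ {f > sSup S}`.
  set S : Set ℝ := {t | μ {x | f x < t} ≤ 1 / 2} with hS
  have hlt : ∀ t, MeasurableSet {x | f x < t} := fun t => measurableSet_lt hf measurable_const
  have hle : ∀ t, MeasurableSet {x | t ≤ f x} := fun t => measurableSet_le measurable_const hf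
  have hcompl : ∀ t, {x | t ≤ f x}ᶜ = {x | f x < t} := fun t => by ext; simp
  have hge : ∀ t, t ∉ S → μ {x | t ≤ f x} ≤ 1 / 2 := fun t ht => by
    by_contra! h
    have h1 : μ {x | t ≤ f x} + μ {x | f x < t} = 1 := by
      rw [← hcompl]; exact prob_add_prob_compl (hle t)
    have h2 : (1 / 2 : ℝ≥0∞) + 1 / 2 < μ {x | t ≤ f x} + μ {x | f x < t} :=
      ENNReal.add_lt_add h (not_le.1 ht)
    rw [ENNReal.add_halves, h1] at h2
    exact lt_irrefl _ h2
  have hne : S.Nonempty := by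
    by_contra hemp
    rw [not_nonempty_iff_eq_empty] at hemp
    refine not_forall_measure_le_half (μ := μ) (A := fun n : ℕ => {x | -(n : ℝ) ≤ f x})
      (fun m n hmn x (hx : -(m : ℝ) ≤ f x) => le_trans (by gcongr) hx) ?_
      fun n => hge _ (by simp [hemp])
    refine eq_univ_of_forall fun x => mem_iUnion.2 ?_
    obtain ⟨n, hn⟩ := exists_nat_ge (-f x)
    exact ⟨n, by simp only [mem_ofPred_eq]; linarith⟩
  have hbdd : BddAbove S := by
    by_contra hunb
    rw [not_bddAbove_iff] at hunb
    refine not_forall_measure_le_half (μ := μ) (A := fun n : ℕ => {x | f x < n})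
      (fun m n hmn x (hx : f x < m) => hx.trans_le (by gcongr)) ?_ fun n => ?_
    · refine eq_univ_of_forall fun x => mem_iUnion.2 ?_
      obtain ⟨n, hn⟩ := exists_nat_gt (f x)
      exact ⟨n, hn⟩
    · obtain ⟨t, ht, hnt⟩ := hunb n
      exact (measure_mono fun x (hx : f x < n) => hx.trans hnt).trans ht
  refine ⟨sSup S, half_le_measure_of_compl (hle _) ?_,
    half_le_measure_of_compl (measurableSet_le hf measurable_const) ?_⟩
  · obtain ⟨u, hu, hlim, huS⟩ := exists_seq_tendsto_sSup hne hbdd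
    rw [hcompl]
    refine (measure_mono (t := ⋃ n, {x | f x < u n}) fun x (hx : f x < sSup S) => ?_).trans
      (measure_iUnion_le_of_forall_le
        (fun m n hmn x (hx : f x < u m) => hx.trans_le (hu hmn)) huS)
    obtain ⟨n, hn⟩ := (hlim.eventually (lt_mem_nhds hx)).exists
    exact mem_iUnion.2 ⟨n, hn⟩
  · obtain ⟨u, hu, hgt, hlim⟩ := exists_seq_strictAnti_tendsto (sSup S)
    have : {x | f x ≤ sSup S}ᶜ ⊆ ⋃ n, {x | u n ≤ f x} := fun x hx => by
      obtain ⟨n, hn⟩ := (hlim.eventually (gt_mem_nhds (not_le.1 hx))).exists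
      exact mem_iUnion.2 ⟨n, hn.le⟩
    exact (measure_mono this).trans (measure_iUnion_le_of_forall_le
      (fun m n hmn x (hx : u m ≤ f x) => (hu.antitone hmn).trans hx)
      fun n => hge _ fun h => not_le.2 (hgt n) (le_csSup hbdd h))

/-- In a r.i. space, the distance to the mean is controlled by the distance to any constant. -/
theorem RINorm.exists_sub_integral_le (Y : RINorm μ) : ∃ C : ℝ≥0, ∀ f : Ω → ℝ, Measurable f →
    ∀ m : ℝ, Y.toFun (fun x => ENNReal.ofReal |f x - m|) < ∞ → Integrable f μ ∧
      Y.toFun (fun x => ENNReal.ofReal |f x - ∫ y, f y ∂μ|) ≤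
        C * Y.toFun (fun x => ENNReal.ofReal |f x - m|) := by
  obtain ⟨C, hC⟩ := Y.lintegral_le univ MeasurableSet.univ (measure_lt_top _ _)
  have h1 := Y.indicator_lt_top univ MeasurableSet.univ (measure_lt_top _ _)
  rw [indicator_univ] at h1
  set y₁ : ℝ≥0 := (Y.toFun fun _ => 1).toNNReal with hy₁
  have hy : (y₁ : ℝ≥0∞) = Y.toFun fun _ => 1 := ENNReal.coe_toNNReal h1.ne
  refine ⟨1 + C * y₁, fun f hf m hfin => ?_⟩
  have hm : Measurable fun x => ENNReal.ofReal |f x - m| :=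
    (measurable_norm.comp (hf.sub_const m)).ennreal_ofReal
  have hint := hC _ hm
  rw [setLIntegral_univ] at hint
  have hfm : Integrable (fun x => f x - m) μ := by
    refine ⟨(hf.sub_const m).aestronglyMeasurable, ?_⟩
    rw [hasFiniteIntegral_iff_norm]
    exact hint.trans_lt (ENNReal.mul_lt_top ENNReal.coe_lt_top hfin)
  have hfi : Integrable f μ := by
    exact (hfm.add (integrable_const m)).congr (Eventually.of_forall fun x => by simp)
  refine ⟨hfi, ?_⟩
  have hmean : ENNReal.ofReal |m - ∫ y, f y ∂μ| ≤
      C * Y.toFun (fun x => ENNReal.ofReal |f x - m|) := by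
    refine le_trans ?_ hint
    have h2 : ∫ x, (f x - m) ∂μ = ∫ y, f y ∂μ - m := by
      rw [integral_sub hfi (integrable_const m)]; simp
    rw [abs_sub_comm, ← h2, ← Real.norm_eq_abs, ofReal_norm]
    refine (enorm_integral_le_lintegral_enorm _).trans (lintegral_mono fun x => ?_)
    rw [← ofReal_norm, Real.norm_eq_abs]
  calc Y.toFun (fun x => ENNReal.ofReal |f x - ∫ y, f y ∂μ|)
      ≤ Y.toFun (fun x => ENNReal.ofReal |f x - m| +
          ((Real.toNNReal |m - ∫ y, f y ∂μ| : ℝ≥0) : ℝ≥0∞) * 1) := by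
        refine Y.mono _ _ (measurable_norm.comp (hf.sub_const _)).ennreal_ofReal
          (hm.add_const _) (Eventually.of_forall fun x => ?_)
        rw [mul_one]
        change _ ≤ _ + ENNReal.ofReal _
        rw [← ENNReal.ofReal_add (abs_nonneg _) (abs_nonneg _)]
        exact ENNReal.ofReal_le_ofReal (abs_sub_le _ _ _)
    _ ≤ Y.toFun (fun x => ENNReal.ofReal |f x - m|) +
          ENNReal.ofReal |m - ∫ y, f y ∂μ| * y₁ := by
        refine (Y.triangle _ _ hm measurable_const).trans ?_
        rw [Y.homogeneous _ (fun _ => 1) measurable_const, hy]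
        rfl
    _ ≤ Y.toFun (fun x => ENNReal.ofReal |f x - m|) +
          C * Y.toFun (fun x => ENNReal.ofReal |f x - m|) * y₁ := by gcongr
    _ = _ := by push_cast; ring

end Median

theorem OrliczPoincare.riPoincare {Ω : Type*} [MetricSpace Ω] [MeasurableSpace Ω] [BorelSpace Ω]
    {μ : Measure Ω} [IsProbabilityMeasure μ] {N : ℝ → ℝ} (hN : IsYoungFunction N) {q : ℝ}
    (hq : 1 ≤ q) (h : OrliczPoincare μ N q) :
    RIPoincare (luxemburgRINorm (IsYoungFunction.rpow hq) μ) (luxemburgRINorm hN μ) := by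
  obtain ⟨P, hP, h⟩ := h
  obtain ⟨C, hC⟩ := (luxemburgRINorm hN μ).exists_sub_integral_le
  refine ⟨C * Real.toNNReal P, fun f hf hfin => ?_⟩
  have hfm := hf.continuous.measurable
  obtain ⟨m, hm⟩ := exists_isMedian (μ := μ) hfm
  have h1 : (luxemburgRINorm hN μ).toFun (fun x => ENNReal.ofReal |f x - m|) ≤
      ENNReal.ofReal P * (luxemburgRINorm (IsYoungFunction.rpow hq) μ).toFun (gradMod f) := by
    refine (eLuxNorm_ofReal_abs N μ fun x => f x - m).le.trans ((h f hf m hm).trans ?_)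
    gcongr
    exact eLpNorm_le_eLuxNorm_rpow (by linarith) _
  obtain ⟨hi, h2⟩ := hC f hfm m (h1.trans_lt (ENNReal.mul_lt_top ENNReal.ofReal_lt_top hfin))
  refine ⟨hi, h2.trans ?_⟩
  rw [ENNReal.coe_mul, mul_assoc]
  gcongr
  exact h1

/-! ### Boundedness of the Hardy operator implies the profile bound -/

/-- The modular of the indicator at scale `v` is `t N(κ / v)`, so admissibility means `κ / v ≤
N⁻¹(1/t)`. -/
theorem ofReal_div_youngInv_le_eLuxNorm {N : ℝ → ℝ} (hN : IsYoungFunction N)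
    (hpos : ∀ t, 0 < t → 0 < N t) {t κ : ℝ} (ht : 0 < t) (ht1 : t ≤ 1) (hκ : 0 ≤ κ) :
    ENNReal.ofReal (κ / youngInv N (1 / t)) ≤
      eLuxNorm N unitMeasure ((Ioo 0 t).indicator fun _ => ENNReal.ofReal κ) := by
  obtain ⟨hw, hNw⟩ := hN.youngInv_spec hpos (one_div_pos.2 ht)
  refine le_eLuxNorm fun v hv h => ENNReal.ofReal_le_ofReal ?_
  have h1 : ∀ s, youngExt N ((Ioo 0 t).indicator (fun _ => ENNReal.ofReal κ) s /
      ENNReal.ofReal v) = (Ioo 0 t).indicator (fun _ => ENNReal.ofReal (N (κ / v))) s := fun s => by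
    by_cases hs : s ∈ Ioo 0 t
    · rw [indicator_of_mem hs, indicator_of_mem hs, ← ENNReal.ofReal_div_of_pos hv,
        youngExt_ofReal N (by positivity)]
    · rw [indicator_of_notMem hs, indicator_of_notMem hs, ENNReal.zero_div, hN.youngExt_zero]
  simp_rw [h1] at h
  have hnn : 0 ≤ N (κ / v) := hN.nonneg (by positivity)
  rw [lintegral_indicator_const measurableSet_Ioo, unitMeasure_Ioo_zero ht1,
    ← ENNReal.ofReal_mul hnn, ENNReal.ofReal_le_one, ← le_div_iff₀ ht, ← hNw,
    (hN.strictMonoOn hpos).le_iff_le (mem_Ici.2 (by positivity)) hw.le, div_le_iff₀ hv] at h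
  rw [div_le_iff₀ hw]
  linarith

theorem eLuxNorm_rpow_indicator_le {q : ℝ} (hq : 1 ≤ q) {t : ℝ} (ht : 0 < t) :
    eLuxNorm (fun s => s ^ q) unitMeasure ((Ioo t (2 * t)).indicator fun _ => 1) ≤
      ENNReal.ofReal (t ^ (1 / q)) := by
  have hq0 : 0 < q := by linarith
  refine eLuxNorm_le (by positivity) ?_
  have h1 : ∀ s, youngExt (fun s => s ^ q) ((Ioo t (2 * t)).indicator (fun _ => 1) s /
      ENNReal.ofReal (t ^ (1 / q))) =
      (Ioo t (2 * t)).indicator (fun _ => ENNReal.ofReal t⁻¹) s := fun s => by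
    rw [youngExt_rpow hq0]
    by_cases hs : s ∈ Ioo t (2 * t)
    · rw [indicator_of_mem hs, indicator_of_mem hs, one_div (ENNReal.ofReal _), ENNReal.inv_rpow,
        ENNReal.ofReal_rpow_of_nonneg (by positivity) hq0.le, ← Real.rpow_mul ht.le,
        one_div_mul_cancel hq0.ne', Real.rpow_one, ENNReal.ofReal_inv_of_pos ht]
    · rw [indicator_of_notMem hs, indicator_of_notMem hs, ENNReal.zero_div,
        ENNReal.zero_rpow_of_pos hq0]
  simp_rw [h1]
  rw [lintegral_indicator_const measurableSet_Ioo]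
  calc _ ≤ ENNReal.ofReal t⁻¹ * volume (Ioo t (2 * t)) := by
        gcongr; exact Measure.restrict_le_self
    _ = 1 := by
        rw [Real.volume_Ioo, ← ENNReal.ofReal_mul (by positivity), show 2 * t - t = t by ring,
          inv_mul_cancel₀ ht.ne', ENNReal.ofReal_one]

/-- For `s < t` the operator integrates `1 / I` over all of `(t, 2t)`, where `I ≤ I(2t)`. -/
theorem indicator_le_isoHardyOp {I : ℝ → ℝ} (hI : IsProfileShape I) {t : ℝ} (ht : 0 < t)
    (ht2 : 2 * t ≤ 1 / 2) (s : ℝ) :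
    (Ioo 0 t).indicator (fun _ => ENNReal.ofReal (t / I (2 * t))) s ≤
      isoHardyOp I ((Ioo t (2 * t)).indicator fun _ => 1) s := by
  refine indicator_apply_le fun hs => ?_
  have hI0 : 0 < I (2 * t) := hI.pos _ ⟨by linarith, by linarith⟩
  calc ENNReal.ofReal (t / I (2 * t)) = ∫⁻ _ in Ioo t (2 * t), 1 / ENNReal.ofReal (I (2 * t)) := by
        rw [setLIntegral_const, Real.volume_Ioo, show 2 * t - t = t by ring,
          ENNReal.ofReal_div_of_pos hI0, one_div, div_eq_mul_inv,
          mul_comm (ENNReal.ofReal t)]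
    _ ≤ ∫⁻ r in Ioo t (2 * t),
        (Ioo t (2 * t)).indicator (fun _ => 1) r / ENNReal.ofReal (I r) := by
        refine setLIntegral_mono' measurableSet_Ioo fun r hr => ?_
        rw [indicator_of_mem hr]
        gcongr
        exact hI.monotoneOn_Icc ⟨by linarith [hr.1], by linarith [hr.2]⟩ ⟨by linarith, ht2⟩ hr.2.le
    _ ≤ _ := lintegral_mono_set (Ioo_subset_Ioo hs.2.le (by linarith))

theorem IsoHardyBounded.profileBound {I : ℝ → ℝ} (hI : IsProfileShape I) {N : ℝ → ℝ}
    (hN : IsYoungFunction N) (hpos : ∀ t, 0 < t → 0 < N t) {q : ℝ} (hq : 1 ≤ q)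
    (h : IsoHardyBounded I (luxemburgRINorm (IsYoungFunction.rpow hq) unitMeasure)
      (luxemburgRINorm hN unitMeasure)) : ProfileBound N q I := by
  obtain ⟨c, hc⟩ := h
  have hq0 : 0 < q := by linarith
  -- The `4` pays for passing from `t` to `r = 2 t`: a factor `2` in the power and a factor `2` in
  -- `N⁻¹`. Using `c + 1` avoids dividing by zero.
  refine ⟨1 / (4 * (c + 1)), by positivity, fun r hr => ?_⟩
  obtain ⟨t, rfl⟩ : ∃ t, r = 2 * t := ⟨r / 2, by ring⟩
  have ht : 0 < t := by linarith [hr.1]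
  have hI0 : 0 < I (2 * t) := hI.pos _ ⟨hr.1, by linarith [hr.2]⟩
  obtain ⟨hw, -⟩ := hN.youngInv_spec hpos (one_div_pos.2 ht)
  obtain ⟨hw2, -⟩ := hN.youngInv_spec hpos (one_div_pos.2 hr.1)
  have h1 := hc ((Ioo t (2 * t)).indicator fun _ => 1) (measurable_const.indicator measurableSet_Ioo)
    fun s hs => indicator_of_notMem (fun hs' => hs ⟨ht.trans hs'.1, hs'.2.trans_le hr.2⟩) _
  have h2 : ENNReal.ofReal (t / I (2 * t) / youngInv N (1 / t)) ≤
      ENNReal.ofReal (c * t ^ (1 / q)) := by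
    rw [ENNReal.ofReal_mul c.coe_nonneg, ENNReal.ofReal_coe_nnreal]
    refine (ofReal_div_youngInv_le_eLuxNorm hN hpos ht (by linarith [hr.2])
      (by positivity)).trans ?_
    refine (eLuxNorm_mono_ae hN (Eventually.of_forall
      (indicator_le_isoHardyOp hI ht hr.2))).trans (h1.trans ?_)
    gcongr
    exact eLuxNorm_rpow_indicator_le hq ht
  rw [ENNReal.ofReal_le_ofReal_iff (by positivity), div_div, div_le_iff₀ (by positivity)] at h2
  have h3 : youngInv N (1 / t) ≤ 2 * youngInv N (1 / (2 * t)) := by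
    have := hN.youngInv_two_mul_le hpos (one_div_pos.2 hr.1)
    rwa [show 2 * (1 / (2 * t)) = 1 / t by field_simp] at this
  have h4 : (2 * t) ^ (1 - 1 / q) ≤ 2 * t ^ (1 - 1 / q) := by
    rw [Real.mul_rpow two_pos.le ht.le]
    gcongr
    calc (2 : ℝ) ^ (1 - 1 / q) ≤ 2 ^ (1 : ℝ) :=
          Real.rpow_le_rpow_of_exponent_le one_le_two (sub_le_self _ (by positivity))
      _ = 2 := Real.rpow_one 2
  have h5 : t = t ^ (1 - 1 / q) * t ^ (1 / q) := by
    rw [← Real.rpow_add ht, sub_add_cancel, Real.rpow_one]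
  have htq : 0 < t ^ (1 / q) := by positivity
  have h6 : t ^ (1 - 1 / q) ≤ c * (I (2 * t) * youngInv N (1 / t)) := by
    refine le_of_mul_le_mul_right ?_ htq
    rw [← h5]
    linarith
  have h7 : t ^ (1 - 1 / q) ≤ (c + 1) * (I (2 * t) * (2 * youngInv N (1 / (2 * t)))) := by
    refine h6.trans ?_
    gcongr
    linarith
  rw [one_div_mul_eq_div, div_div, div_le_iff₀ (by positivity)]
  linarith

/-! ### The three equivalences. -/

theorem mainTheorem5 {Ω : Type*} [MetricSpace Ω] [ConnectedSpace Ω] [MeasurableSpace Ω]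
    [BorelSpace Ω] (μ : Measure Ω) [IsProbabilityMeasure μ] [NullSingletonClass μ]
    (hprofile : HasRegularProfile μ) (hgrad : GradientVanishesOnLevelSets μ)
    (q : ℝ) (hq : 1 ≤ q) (N : ℝ → ℝ) (hN : IsYoungFunction N)
    (hmono : MonotoneOn (fun t => N t ^ (1 / q) / t) (Ioi 0))
    (hanti : ∃ α : ℝ, max (1 / q - 1 / 2) 0 < α ∧ AntitoneOn (fun t => N (t ^ α) / t) (Ioi 0)) :
    (IsIsoperimetricHardyType μ →
      (OrliczPoincare μ N q ↔ ∀ I : ℝ → ℝ, IsIsoperimetricEstimator μ I → ProfileBound N q I)) ∧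
    ((∀ I : ℝ → ℝ, IsIsoperimetricEstimator μ I → ProfileBound N q I) → OrliczPoincare μ N q) ∧
    (∀ I : ℝ → ℝ, IsIsoperimetricEstimator μ I →
      (ProfileBound N q I → OrliczPoincare μ N q) ∧
      (HardyEquivalence μ I → (OrliczPoincare μ N q ↔ ProfileBound N q I))) := by
  obtain ⟨α, hα, hanti⟩ := hanti
  have hα0 : 0 < α := (le_max_right _ _).trans_lt hα
  obtain ⟨J, hJ, hJI⟩ := hprofile
  -- The profile is itself an estimator, so a bound assumed for all estimators is not vacuous.
  have hJe : IsIsoperimetricEstimator μ J := ⟨hJ, fun t ht => (hJI t ht).ge⟩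
  have hsuff : ∀ I, IsIsoperimetricEstimator μ I → ProfileBound N q I → OrliczPoincare μ N q :=
    fun I hI h => h.orliczPoincare hgrad hI hN hq hmono hα0 hanti
  have hnec : ∀ I, IsIsoperimetricEstimator μ I → HardyEquivalence μ I → OrliczPoincare μ N q →
      ProfileBound N q I := fun I hI hH h =>
    IsoHardyBounded.profileBound hI.1 hN (fun t => hN.pos_of_antitoneOn hα0 hanti) hq
      ((hH _ _ _ _ (represents_luxemburgRINorm _ μ) (represents_luxemburgRINorm _ μ)).1
        (h.riPoincare hN hq))
  have hall : (∀ I : ℝ → ℝ, IsIsoperimetricEstimator μ I → ProfileBound N q I) →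
      OrliczPoincare μ N q := fun h => hsuff J hJe (h J hJe)
  exact ⟨fun hH => ⟨fun h I hI => hnec I hI (hH I hI) h, hall⟩, hall,
    fun I hI => ⟨hsuff I hI, fun hH => ⟨hnec I hI hH, hsuff I hI⟩⟩⟩

end
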